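/- Let $k$ be a field of characteristic zero and let $q\in k^\times$ be not a root of unity, with a square root $\hat q\in k^\times$, $\hat q^2=q$. Let $D=k_q(x,y)$ be the division ring of fractions of the quantum plane $k_q[x,y]=k\langle x,y\rangle/(xy-qyx)$, and give $F=k(x,y)$ the Poisson bracket $\{a,b\}=yx\left(\frac{\partial a}{\partial y}\frac{\partial b}{\partial x}-\frac{\partial a}{\partial x}\frac{\partial b}{\partial y}\right)$, so that $\{y,x\}=yx$. Let $\mathfrak B=k\langle x^{\pm1},y^{\pm1},z^{\pm1}\rangle/(xz-zx,\;yz-zy,\;xy-z^2yx)$, let $\mathcal C$ be the set of elements of $\mathfrak B$ that are regular modulo every prime ideal of height one, and let $\mathfrak D=\mathfrak B\mathcal C^{-1}$. Put $h=2(1-z)$ and $\lambda=2(1-\hat q)$. A $k$-algebra $A$ is called a deformation of a commutative Poisson $k$-algebra $R$ via a $k$-algebra $B$, an element $h\in B$ and $\lambda\in k^\times$ if $h$ is central, not invertible and not a zero divisor, $B/hB\cong R$ as Poisson algebras, where $B/hB$ carries the bracket $\{a+hB,b+hB\}=\frac1h(ab-ba)+hB$, the ideal of $B$ generated by $h-\lambda$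 is proper and nonzero, and $B/(h-\lambda)B\cong A$ as $k$-algebras. Then: (1) The division ring of fractions $D$ of $k_q[x,y]$ and the (two-sided) ring of fractions $\mathfrak D=\mathfrak B\mathcal C^{-1}$ exist, and $D$ is a deformation of $F$ via $\mathfrak D$, $h$ and $\lambda$. (2) $SL_2(\mathbb Z)$ acts by $k$-algebra automorphisms on $F$, $D$ and $\mathfrak D$ through $g.y=Z^{ac}y^ax^c$, $g.x=Z^{bd}y^bx^d$, $g.Z=Z$ for $g=\begin{pmatrix}a&b\\c&d\end{pmatrix}$, where $Z=1$ on $F$, $Z=\hat q$ on $D$ and $Z=z$ on $\mathfrak D$; on $F$ it acts by Poisson automorphisms. (3) For every finite subgroup $G\subset SL_2(\mathbb Z)$, the fixed ring $F^G$ is closed under the Poisson bracket, $h\in\mathfrak D^G$, and $D^G$ is a deformation of $F^G$, with the induced bracket, via $\mathfrak D^G$, $h$ and $\lambda$. -/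

import Mathlib

/-! ### Poisson algebras and deformations -/

/-- A Poisson bracket on a commutative `k`-algebra `A`. -/
structure PoissonBracket (k A : Type*) [CommRing k] [CommRing A] [Algebra k A] where
  /-- the underlying `k`-bilinear map -/
  bracket : A →ₗ[k] A →ₗ[k] A
  self : ∀ a, bracket a a = 0
  jacobi : ∀ a b c,
    bracket a (bracket b c) + bracket b (bracket c a) + bracket c (bracket a b) = 0
  leibniz : ∀ a b c, bracket a (b * c) = bracket a b * c + b * bracket a c

/-- The restriction of a Poisson bracket to a subalgebra that is closed under it. -/
def PoissonBracket.restrict {k A : Type*} [CommRing k] [CommRing A] [Algebra k A]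
    (P : PoissonBracket k A) (S : Subalgebra k A)
    (hS : ∀ a ∈ S, ∀ b ∈ S, P.bracket a b ∈ S) : PoissonBracket k S where
  bracket := LinearMap.mk₂ k (fun a b : S => ⟨P.bracket a b, hS a a.2 b b.2⟩)
    (fun a b c => Subtype.ext (by simp)) (fun r a b => Subtype.ext (by simp))
    (fun a b c => Subtype.ext (by simp)) (fun r a b => Subtype.ext (by simp))
  self a := Subtype.ext (by simpa using P.self a)
  jacobi a b c := Subtype.ext (by simpa using P.jacobi a b c)
  leibniz a b c := Subtype.ext (by simpa using P.leibniz a b c)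

/-- The quotient `B / ⟨h⟩` of a ring by the two-sided ideal generated by `h`
(which is `hB` when `h` is central). -/
abbrev QuotBy {B : Type*} [Ring B] (h : B) : Type _ := (TwoSidedIdeal.span {h}).ringCon.Quotient

/-- `A` is the deformation `B / (h - lam)B` of the commutative Poisson algebra `(R, P)`:
`h` is a central, non-invertible non-zero-divisor of the `k`-algebra `B`, there is an isomorphism
of algebras `B / hB ≃ R` that carries the bracket `{a, b} = (ab - ba) / h` modulo `hB` to `P`,
`lam` is a nonzero scalar such that `h - lam` generates a proper nonzero ideal, and
`B / (h - lam)B ≃ A` as algebras. -/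
structure IsDeformationVia {k R : Type*} [Field k] [CommRing R] [Algebra k R]
    (P : PoissonBracket k R) (A : Type*) [Ring A] [Algebra k A]
    (B : Type*) [Ring B] [Algebra k B] (h : B) (lam : k) : Prop where
  central : ∀ b : B, h * b = b * h
  not_isUnit : ¬ IsUnit h
  regular : h ∈ nonZeroDivisors B
  limit : ∃ e : QuotBy h ≃ₐ[k] R, ∀ a b c : B, a * b - b * a = h * c →
    P.bracket (e (a : QuotBy h)) (e (b : QuotBy h)) = e (c : QuotBy h)
  lam_ne_zero : lam ≠ 0
  ideal_ne_bot : TwoSidedIdeal.span {h - algebraMap k B lam} ≠ ⊥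
  ideal_ne_top : TwoSidedIdeal.span {h - algebraMap k B lam} ≠ ⊤
  quotient : Nonempty (QuotBy (h - algebraMap k B lam) ≃ₐ[k] A)

/-! ### Localization of noncommutative algebras -/

/-- The relations that make the generators `inl r` a copy of the `k`-algebra `R`, and each `inr s`
a two-sided inverse of `inl s`. -/
inductive InvertRel (k : Type*) {R : Type*} [CommRing k] [Ring R] [Algebra k R] (S : Set R) :
    FreeAlgebra k (R ⊕ S) → FreeAlgebra k (R ⊕ S) → Prop
  | add (a b : R) : InvertRel k S (FreeAlgebra.ι k (Sum.inl (a + b)))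
      (FreeAlgebra.ι k (Sum.inl a) + FreeAlgebra.ι k (Sum.inl b))
  | mul (a b : R) : InvertRel k S (FreeAlgebra.ι k (Sum.inl (a * b)))
      (FreeAlgebra.ι k (Sum.inl a) * FreeAlgebra.ι k (Sum.inl b))
  | scalar (c : k) : InvertRel k S (FreeAlgebra.ι k (Sum.inl (algebraMap k R c)))
      (algebraMap k (FreeAlgebra k (R ⊕ S)) c)
  | mul_inv (s : S) : InvertRel k S
      (FreeAlgebra.ι k (Sum.inl (s : R)) * FreeAlgebra.ι k (Sum.inr s)) 1
  | inv_mul (s : S) : InvertRel k S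
      (FreeAlgebra.ι k (Sum.inr s) * FreeAlgebra.ι k (Sum.inl (s : R))) 1

/-- The localization of the `k`-algebra `R` at a set `S`: the universal `k`-algebra under `R` in
which the elements of `S` are invertible. When `S` is a multiplicative Ore set of regular elements
this is the ring of fractions `RS⁻¹ = S⁻¹R`, see `IsRingOfFractions`. -/
abbrev Loc (k : Type*) {R : Type*} [CommRing k] [Ring R] [Algebra k R] (S : Set R) : Type _ :=
  RingQuot (InvertRel k S)

/-- The canonical map `R → Loc k S`. -/
noncomputable def Loc.of (k : Type*) {R : Type*} [CommRing k] [Ring R] [Algebra k R] (S : Set R) :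
    R →ₐ[k] Loc k S :=
  AlgHom.ofLinearMap
    { toFun := fun r => RingQuot.mkAlgHom k (InvertRel k S) (FreeAlgebra.ι k (Sum.inl r))
      map_add' := fun a b => by
        rw [RingQuot.mkAlgHom_rel k (InvertRel.add a b), map_add]
      map_smul' := fun c a => by
        rw [Algebra.smul_def, RingQuot.mkAlgHom_rel k (InvertRel.mul _ _), map_mul,
          RingQuot.mkAlgHom_rel k (InvertRel.scalar c), AlgHom.commutes, RingHom.id_apply,
          Algebra.smul_def] }
    (by
      have h := RingQuot.mkAlgHom_rel k (InvertRel.scalar (S := S) (1 : k))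
      rw [map_one, map_one, map_one] at h
      exact h)
    (fun a b => by
      have h := RingQuot.mkAlgHom_rel k (InvertRel.mul (k := k) (S := S) a b)
      rw [map_mul] at h
      exact h)

/-- An element of `S` as a unit of the localization. -/
noncomputable def Loc.unit (k : Type*) {R : Type*} [CommRing k] [Ring R] [Algebra k R] {S : Set R}
    {s : R} (hs : s ∈ S) : (Loc k S)ˣ where
  val := Loc.of k S s
  inv := RingQuot.mkAlgHom k (InvertRel k S) (FreeAlgebra.ι k (Sum.inr ⟨s, hs⟩))
  val_inv := by
    have h := RingQuot.mkAlgHom_rel k (InvertRel.mul_inv (k := k) (S := S) ⟨s, hs⟩)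
    rw [map_mul, map_one] at h
    exact h
  inv_val := by
    have h := RingQuot.mkAlgHom_rel k (InvertRel.inv_mul (k := k) (S := S) ⟨s, hs⟩)
    rw [map_mul, map_one] at h
    exact h

/-- `f : R → Q` exhibits `Q` as the two-sided ring of fractions `RS⁻¹ = S⁻¹R` of `R` with respect
to a set `S` of regular elements. -/
structure IsRingOfFractions {R Q : Type*} [Ring R] [Ring Q] (S : Set R) (f : R →+* Q) : Prop where
  injective : Function.Injective f
  isUnit : ∀ s ∈ S, IsUnit (f s)
  right_fraction : ∀ q : Q, ∃ r : R, ∃ s ∈ S, q * f s = f r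
  left_fraction : ∀ q : Q, ∃ r : R, ∃ s ∈ S, f s * q = f r

/-! ### The set of elements that are regular modulo all height one primes -/

/-- A two-sided ideal `P` is prime if it is proper and `aRb ⊆ P` implies `a ∈ P` or `b ∈ P`. -/
def IsPrimeTwoSided {R : Type*} [Ring R] (P : TwoSidedIdeal R) : Prop :=
  P ≠ ⊤ ∧ ∀ a b : R, (∀ r : R, a * r * b ∈ P) → a ∈ P ∨ b ∈ P

/-- The spectrum of prime two-sided ideals, ordered by inclusion. -/
abbrev PrimeTwoSided (R : Type*) [Ring R] : Type _ := {P : TwoSidedIdeal R // IsPrimeTwoSided P}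

/-- The elements of `R` that are regular modulo every prime ideal of height one. -/
def heightOneRegular (R : Type*) [Ring R] : Set R :=
  {c | ∀ P : PrimeTwoSided R, Order.height P = 1 →
    ∀ r : R, (c * r ∈ P.1 → r ∈ P.1) ∧ (r * c ∈ P.1 → r ∈ P.1)}

/-! ### The `q`-division ring -/

/-- The relation `xy = q yx`, where `x` is the generator `0` and `y` is the generator `1`. -/
inductive QPlaneRel {k : Type*} [Field k] (q : k) :
    FreeAlgebra k (Fin 2) → FreeAlgebra k (Fin 2) → Prop
  | comm : QPlaneRel q (FreeAlgebra.ι k 0 * FreeAlgebra.ι k 1)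
      (q • (FreeAlgebra.ι k 1 * FreeAlgebra.ι k 0))

/-- The quantum plane `k_q[x, y] = k⟨x, y⟩ / (xy - q yx)`. -/
abbrev QPlane {k : Type*} [Field k] (q : k) : Type _ := RingQuot (QPlaneRel q)

/-- The generators `x` (for `i = 0`) and `y` (for `i = 1`) of the quantum plane. -/
noncomputable def QPlane.gen {k : Type*} [Field k] (q : k) (i : Fin 2) : QPlane q :=
  RingQuot.mkAlgHom k (QPlaneRel q) (FreeAlgebra.ι k i)

theorem QPlane.gen_ne_zero {k : Type*} [Field k] (q : k) (i : Fin 2) : QPlane.gen q i ≠ 0 := by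
  let f : FreeAlgebra k (Fin 2) →ₐ[k] Polynomial k :=
    FreeAlgebra.lift k (fun j => if j = i then Polynomial.X else 0)
  have hf : ∀ ⦃a b : FreeAlgebra k (Fin 2)⦄, QPlaneRel q a b → f a = f b := by
    rintro _ _ ⟨⟩
    fin_cases i <;> simp [f]
  intro h
  have h2 := congrArg (RingQuot.liftAlgHom k ⟨f, hf⟩) h
  simp [QPlane.gen, f] at h2

/-- The `q`-division ring `D = k_q(x, y)`: the quantum plane localized at all nonzero elements. -/
abbrev QDiv {k : Type*} [Field k] (q : k) : Type _ := Loc k {r : QPlane q | r ≠ 0}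

/-- The generators `x` and `y` as units of `k_q(x, y)`. -/
noncomputable def QDiv.gen {k : Type*} [Field k] (q : k) (i : Fin 2) : (QDiv q)ˣ :=
  Loc.unit k (s := QPlane.gen q i) (QPlane.gen_ne_zero q i)

/-! ### The rings `𝔅` and `𝔇` -/

/-- The symbols `x, x⁻¹, y, y⁻¹, z, z⁻¹`. -/
inductive BGen
  | x | xi | y | yi | z | zi

/-- The relations of `k⟨x^{±1}, y^{±1}, z^{±1}⟩ / (xz - zx, yz - zy, xy - z²yx)`. -/
inductive BRel (k : Type*) [Field k] : FreeAlgebra k BGen → FreeAlgebra k BGen → Prop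
  | x_xi : BRel k (FreeAlgebra.ι k .x * FreeAlgebra.ι k .xi) 1
  | xi_x : BRel k (FreeAlgebra.ι k .xi * FreeAlgebra.ι k .x) 1
  | y_yi : BRel k (FreeAlgebra.ι k .y * FreeAlgebra.ι k .yi) 1
  | yi_y : BRel k (FreeAlgebra.ι k .yi * FreeAlgebra.ι k .y) 1
  | z_zi : BRel k (FreeAlgebra.ι k .z * FreeAlgebra.ι k .zi) 1
  | zi_z : BRel k (FreeAlgebra.ι k .zi * FreeAlgebra.ι k .z) 1
  | xz : BRel k (FreeAlgebra.ι k .x * FreeAlgebra.ι k .z) (FreeAlgebra.ι k .z * FreeAlgebra.ι k .x)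
  | yz : BRel k (FreeAlgebra.ι k .y * FreeAlgebra.ι k .z) (FreeAlgebra.ι k .z * FreeAlgebra.ι k .y)
  | xy : BRel k (FreeAlgebra.ι k .x * FreeAlgebra.ι k .y)
      (FreeAlgebra.ι k .z ^ 2 * FreeAlgebra.ι k .y * FreeAlgebra.ι k .x)

/-- The ring `𝔅`. -/
abbrev BB (k : Type*) [Field k] : Type _ := RingQuot (BRel k)

/-- The unit `x` of `𝔅`. -/
noncomputable def BB.x (k : Type*) [Field k] : (BB k)ˣ where
  val := RingQuot.mkAlgHom k (BRel k) (FreeAlgebra.ι k .x)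
  inv := RingQuot.mkAlgHom k (BRel k) (FreeAlgebra.ι k .xi)
  val_inv := by rw [← map_mul, RingQuot.mkAlgHom_rel k BRel.x_xi, map_one]
  inv_val := by rw [← map_mul, RingQuot.mkAlgHom_rel k BRel.xi_x, map_one]

/-- The unit `y` of `𝔅`. -/
noncomputable def BB.y (k : Type*) [Field k] : (BB k)ˣ where
  val := RingQuot.mkAlgHom k (BRel k) (FreeAlgebra.ι k .y)
  inv := RingQuot.mkAlgHom k (BRel k) (FreeAlgebra.ι k .yi)
  val_inv := by rw [← map_mul, RingQuot.mkAlgHom_rel k BRel.y_yi, map_one]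
  inv_val := by rw [← map_mul, RingQuot.mkAlgHom_rel k BRel.yi_y, map_one]

/-- The unit `z` of `𝔅`. -/
noncomputable def BB.z (k : Type*) [Field k] : (BB k)ˣ where
  val := RingQuot.mkAlgHom k (BRel k) (FreeAlgebra.ι k .z)
  inv := RingQuot.mkAlgHom k (BRel k) (FreeAlgebra.ι k .zi)
  val_inv := by rw [← map_mul, RingQuot.mkAlgHom_rel k BRel.z_zi, map_one]
  inv_val := by rw [← map_mul, RingQuot.mkAlgHom_rel k BRel.zi_z, map_one]

/-- The ring `𝔇 = 𝔅𝒞⁻¹`, where `𝒞` is the set of elements of `𝔅` that are regular modulo all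
height one primes. -/
abbrev DD (k : Type*) [Field k] : Type _ := Loc k (heightOneRegular (BB k))

/-- The canonical map `𝔅 → 𝔇`. -/
noncomputable abbrev DD.of (k : Type*) [Field k] : BB k →ₐ[k] DD k :=
  Loc.of k (heightOneRegular (BB k))

/-- The unit `x` of `𝔇`. -/
noncomputable def DD.x (k : Type*) [Field k] : (DD k)ˣ := Units.map (DD.of k) (BB.x k)

/-- The unit `y` of `𝔇`. -/
noncomputable def DD.y (k : Type*) [Field k] : (DD k)ˣ := Units.map (DD.of k) (BB.y k)

/-- The unit `z` of `𝔇`. -/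
noncomputable def DD.z (k : Type*) [Field k] : (DD k)ˣ := Units.map (DD.of k) (BB.z k)

/-- The element `h = 2(1 - z)` of `𝔇`. -/
noncomputable def DD.h (k : Type*) [Field k] : DD k := 2 * (1 - (DD.z k : DD k))

/-! ### The Poisson field `k(x, y)` -/

/-- The field `k(x, y)`, where `x` is the variable `0` and `y` is the variable `1`. -/
abbrev RatXY (k : Type*) [Field k] : Type _ := FractionRing (MvPolynomial (Fin 2) k)

/-- The variables `x` (for `i = 0`) and `y` (for `i = 1`) as units of `k(x, y)`. -/
noncomputable def RatXY.gen (k : Type*) [Field k] (i : Fin 2) : (RatXY k)ˣ :=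
  Units.mk0 (algebraMap (MvPolynomial (Fin 2) k) (RatXY k) (MvPolynomial.X i)) (by simp)

/-- The partial derivative of `k(x, y)` with respect to the `i`-th variable: the unique extension of
the partial derivative of polynomials, see `RatXY.pd_algebraMap`. -/
noncomputable def RatXY.pd (k : Type*) [Field k] (i : Fin 2) : Derivation k (RatXY k) (RatXY k) :=
  haveI : Algebra.FormallyEtale (MvPolynomial (Fin 2) k) (RatXY k) :=
    Algebra.FormallyEtale.of_isLocalization (nonZeroDivisors (MvPolynomial (Fin 2) k))
  ((((Algebra.linearMap (MvPolynomial (Fin 2) k) (RatXY k)).compDer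
      (MvPolynomial.pderiv i)).liftKaehlerDifferential.liftBaseChange (RatXY k)).comp
    (KaehlerDifferential.tensorKaehlerEquivOfFormallyEtale k (MvPolynomial (Fin 2) k)
      (RatXY k)).symm.toLinearMap).compDer (KaehlerDifferential.D k (RatXY k))

theorem RatXY.pd_algebraMap (k : Type*) [Field k] (i : Fin 2) (p : MvPolynomial (Fin 2) k) :
    RatXY.pd k i (algebraMap _ (RatXY k) p) = algebraMap _ (RatXY k) (MvPolynomial.pderiv i p) := by
  have : Algebra.FormallyEtale (MvPolynomial (Fin 2) k) (RatXY k) :=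
    Algebra.FormallyEtale.of_isLocalization (nonZeroDivisors (MvPolynomial (Fin 2) k))
  simp [RatXY.pd, KaehlerDifferential.tensorKaehlerEquivOfFormallyEtale_symm_D_algebraMap]

theorem RatXY.derivation_eq_zero {k : Type*} [Field k] (d : Derivation k (RatXY k) (RatXY k))
    (hd : ∀ p : MvPolynomial (Fin 2) k, d (algebraMap _ (RatXY k) p) = 0) (a : RatXY k) :
    d a = 0 := by
  obtain ⟨p, s, hs, rfl⟩ := IsFractionRing.div_surjective (A := MvPolynomial (Fin 2) k) a
  rw [Derivation.leibniz_div]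
  simp [hd]

theorem RatXY.pd_comm (k : Type*) [Field k] (a : RatXY k) :
    RatXY.pd k 0 (RatXY.pd k 1 a) = RatXY.pd k 1 (RatXY.pd k 0 a) := by
  have h : ∀ p : MvPolynomial (Fin 2) k,
      MvPolynomial.pderiv 0 (MvPolynomial.pderiv 1 p) =
        MvPolynomial.pderiv 1 (MvPolynomial.pderiv 0 p) := by
    intro p
    have h2 : ⁅MvPolynomial.pderiv (R := k) (0 : Fin 2),
        MvPolynomial.pderiv (R := k) (1 : Fin 2)⁆ = 0 := by
      apply MvPolynomial.derivation_ext
      intro i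
      fin_cases i <;> simp [Derivation.commutator_apply, MvPolynomial.pderiv_X]
    have h3 := DFunLike.congr_fun h2 p
    simpa [Derivation.commutator_apply, sub_eq_zero] using h3
  have h4 := RatXY.derivation_eq_zero ⁅RatXY.pd k 0, RatXY.pd k 1⁆
    (fun p : MvPolynomial (Fin 2) k => by simp [Derivation.commutator_apply, RatXY.pd_algebraMap, h]) a
  simpa [Derivation.commutator_apply, sub_eq_zero] using h4

/-- The Poisson bracket `{a, b} = yx (∂a/∂y ∂b/∂x - ∂a/∂x ∂b/∂y)` on `k(x, y)`. -/
noncomputable def RatXY.poisson (k : Type*) [Field k] : PoissonBracket k (RatXY k) where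
  bracket := LinearMap.mk₂ k (fun a b : RatXY k => (RatXY.gen k 1 : RatXY k) * RatXY.gen k 0 *
      (RatXY.pd k 1 a * RatXY.pd k 0 b - RatXY.pd k 0 a * RatXY.pd k 1 b))
    (fun a b c => by simp only [map_add]; ring)
    (fun r a b => by rw [Derivation.map_smul, Derivation.map_smul]; simp only [Algebra.smul_def]; ring)
    (fun a b c => by simp only [map_add]; ring)
    (fun r a b => by rw [Derivation.map_smul, Derivation.map_smul]; simp only [Algebra.smul_def]; ring)
  self a := by simp only [LinearMap.mk₂_apply]; ring
  jacobi a b c := by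
    have e : ∀ i j : Fin 2, RatXY.pd k i (RatXY.gen k j : RatXY k) = if i = j then 1 else 0 := by
      intro i j
      simp only [RatXY.gen, Units.val_mk0, RatXY.pd_algebraMap, MvPolynomial.pderiv_X]
      by_cases h : i = j
      · subst h; simp
      · simp [h, Ne.symm h]
    simp only [LinearMap.mk₂_apply, Derivation.leibniz, map_sub, smul_eq_mul, e, RatXY.pd_comm]
    simp
    ring
  leibniz a b c := by
    simp only [LinearMap.mk₂_apply, Derivation.leibniz, smul_eq_mul]; ring

theorem RatXY.poisson_gen (k : Type*) [Field k] :
    (RatXY.poisson k).bracket (RatXY.gen k 1) (RatXY.gen k 0) =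
      (RatXY.gen k 1 : RatXY k) * RatXY.gen k 0 := by
  simp [RatXY.poisson, RatXY.gen, RatXY.pd_algebraMap, MvPolynomial.pderiv_X]

/-! ### Monomial actions of `SL₂(ℤ)` and fixed rings -/

/-- `ρ` is the action of `SL₂(ℤ)` by algebra automorphisms with
`g.y = Z^{ac} y^a x^c`, `g.x = Z^{bd} y^b x^d`, `g.Z = Z` for `g = (a, b; c, d)`.
It is used with `Z = 1` on `k(x, y)`, with `Z = q̂` on `k_q(x, y)` and with `Z = z` on `𝔇`. -/
def IsMonomialAction {k A : Type*} [Field k] [Ring A] [Algebra k A] (x y Z : Aˣ)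
    (ρ : Matrix.SpecialLinearGroup (Fin 2) ℤ →* (A ≃ₐ[k] A)) : Prop :=
  ∀ g : Matrix.SpecialLinearGroup (Fin 2) ℤ,
    ρ g y = ((Z ^ (g 0 0 * g 1 0) * y ^ (g 0 0) * x ^ (g 1 0) : Aˣ) : A) ∧
    ρ g x = ((Z ^ (g 0 1 * g 1 1) * y ^ (g 0 1) * x ^ (g 1 1) : Aˣ) : A) ∧
    ρ g Z = Z

/-- The fixed ring `A^G` of a subgroup `G` of a group `Γ` acting on `A` by algebra automorphisms. -/
def fixedRing {k A Γ : Type*} [Field k] [Ring A] [Algebra k A] [Group Γ] (ρ : Γ →* (A ≃ₐ[k] A))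
    (G : Subgroup Γ) : Subalgebra k A where
  carrier := {a | ∀ g ∈ G, ρ g a = a}
  mul_mem' ha hb g hg := by rw [map_mul, ha g hg, hb g hg]
  add_mem' ha hb g hg := by rw [map_add, ha g hg, hb g hg]
  algebraMap_mem' r g _ := (ρ g).commutes r

/-! Over `A = k[z^{±1}]` the ring `𝔅` is a quantum torus. The normalized monomials `e_(a,c) = z^{ac}
y^a x^c` form an `A`-basis with `e_v e_w = z^{ω(v,w)} e_{v+w}`, where `ω` is the standard symplectic
form (`BB.isTorusBasis`). Independence comes from a representation by shift operators. Matrices in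
`SL₂(ℤ)` preserve `ω`, so `e_v ↦ e_{gv}` respects this rule and gives the action on `𝔅`, with `z`
fixed (`QCommute.slAct`).

The ring `A` is a PID and `z` is not a root of unity. Conjugation by monomials separates the
monomials, so every nonzero ideal of `𝔅` meets `A` nontrivially. With Gauss's lemma
(`IsMonomialBasis.repr_mem_of_mul`) the height one primes are exactly the `f𝔅` with `f ∈ A` prime,
and they are completely prime. Hence `𝒞` consists of the primitive elements, those divisible by no
prime of `A`. A dimension count, based on the slow growth of `ℤ²`, gives common multiples of nonzero
elements; dividing out contents keeps the denominators in `𝒞` (`ore_heightOneRegular`). The same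
count over `ℕ²` handles the quantum plane.

Both `F` and `D` are treated as instances of one notion, `IsTorusField`: a division algebra
generated by `X`, `Y` with `XY = a²YX` and independent monomials, where `a = 1` for `F` and `a = q̂`
for `D`. The map `𝔅 → E`, `z ↦ a`, has kernel `(z - a)𝔅`. Primitive elements avoid it, so the map
extends to `𝔇`, where it is onto with kernel `(z - a)𝔇`. Since `h = -2(z - 1)` and `h - λ = -2(z -
q̂)`, both quotients are identified. The actions on `F` and `D` descend from `𝔇`, because `z - a` is
fixed.

For the bracket, `(a, b) ↦ (ab - ba)/h` modulo `h` and the given bracket are both biderivations, so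
it suffices to compare them on generators (`isCompatible_of_gen`). There `yx - xy = (1 - z²)yx = h ·
(1 + z)yx/2`, which becomes `yx` at `z = 1`. Applying `g` to a relation `ab - ba = hc` shows that
the action on `F` is Poisson. For finite `G`, averaging in characteristic zero lifts invariants, and
regularity of `h` and `h - λ` makes the kernels on invariants principal again
(`IsSpecialization.fixedHom`). -/

open scoped LaurentPolynomial
open Matrix (SpecialLinearGroup)

/-! ### Slow growth of `ℤ²` and `ℕ²` -/

open Pointwise in
/-- The group `ℤ × ℤ` has subexponential growth. -/
theorem exists_card_add_lt_int (F : Finset (ℤ × ℤ)) :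
    ∃ B : Finset (ℤ × ℤ), (F + B).card < 2 * B.card := by
  set d : ℕ := F.sup (fun v => max v.1.natAbs v.2.natAbs) with hd
  have hF : ∀ v ∈ F, max v.1.natAbs v.2.natAbs ≤ d := fun v hv => Finset.le_sup (f := fun v : ℤ × ℤ =>
    max v.1.natAbs v.2.natAbs) hv
  -- A box of side `5d` grows to one of side `7d`, and `7² = 49 < 50 = 2 · 5²`.
  let B : Finset (ℤ × ℤ) := Finset.Icc 0 (5 * (d : ℤ)) ×ˢ Finset.Icc 0 (5 * (d : ℤ))
  let B' : Finset (ℤ × ℤ) := Finset.Icc (-(d : ℤ)) (6 * (d : ℤ)) ×ˢ Finset.Icc (-(d : ℤ)) (6 * (d : ℤ))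
  refine ⟨B, lt_of_le_of_lt (Finset.card_le_card (t := B') ?_) ?_⟩
  · intro u hu
    obtain ⟨f, hf, w, hw, rfl⟩ := Finset.mem_add.1 hu
    have := hF f hf
    simp only [B, B', Finset.mem_product, Finset.mem_Icc, Prod.fst_add, Prod.snd_add] at hw ⊢
    omega
  · have h1 : B'.card = (7 * d + 1) * (7 * d + 1) := by
      simp only [B', Finset.card_product, Int.card_Icc]
      congr <;> omega
    have h2 : B.card = (5 * d + 1) * (5 * d + 1) := by
      simp only [B, Finset.card_product, Int.card_Icc]
      congr 1
    rw [h1, h2]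
    nlinarith

open Pointwise in
theorem exists_card_add_lt_nat (F : Finset (ℕ × ℕ)) :
    ∃ B : Finset (ℕ × ℕ), (F + B).card < 2 * B.card := by
  set d : ℕ := F.sup (fun v => max v.1 v.2) with hd
  have hF : ∀ v ∈ F, max v.1 v.2 ≤ d := fun v hv => Finset.le_sup (f := fun v : ℕ × ℕ =>
    max v.1 v.2) hv
  let B : Finset (ℕ × ℕ) := Finset.range (5 * d + 1) ×ˢ Finset.range (5 * d + 1)
  let B' : Finset (ℕ × ℕ) := Finset.range (6 * d + 1) ×ˢ Finset.range (6 * d + 1)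
  refine ⟨B, lt_of_le_of_lt (Finset.card_le_card (t := B') ?_) ?_⟩
  · intro u hu
    obtain ⟨f, hf, w, hw, rfl⟩ := Finset.mem_add.1 hu
    have := hF f hf
    simp only [B, B', Finset.mem_product, Finset.mem_range, Prod.fst_add, Prod.snd_add] at hw ⊢
    omega
  · simp only [B, B', Finset.card_product, Finset.card_range]
    nlinarith

/-! ### Gauss's lemma and the Ore condition for a basis of monomials -/

section TwistedBasis

variable {ι A R : Type*} [AddCommMonoid ι] [CommRing A] [Ring R] [Algebra A R]

/-- `b` is a basis of monomials: the product of two basis vectors is a unit times the basis vector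
of the sum of the indices. -/
def IsMonomialBasis (b : Module.Basis ι A R) : Prop :=
  ∀ v w, ∃ c : Aˣ, b v * b w = (c : A) • b (v + w)

/-- Gauss's lemma. Reduce modulo `p`: if both reductions are nonzero, their supports contain a pair
whose sum is attained only once, and the product has at that sum a coefficient that is a unit times
two elements outside `p`. -/
theorem IsMonomialBasis.repr_mem_of_mul [UniqueSums ι] {b : Module.Basis ι A R}
    (hb : IsMonomialBasis b) (p : Ideal A) [hp : p.IsPrime] {r s : R}
    (h : ∀ u, b.repr (r * s) u ∈ p) : (∀ u, b.repr r u ∈ p) ∨ (∀ u, b.repr s u ∈ p) := by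
  classical
  choose c hc using hb
  by_contra! hcon
  obtain ⟨⟨v₁, hv₁⟩, ⟨w₁, hw₁⟩⟩ := hcon
  let S := (b.repr r).support.filter (fun v => b.repr r v ∉ p)
  let T := (b.repr s).support.filter (fun v => b.repr s v ∉ p)
  have memS : ∀ v, v ∈ S ↔ b.repr r v ∉ p := fun v => by
    simp only [S, Finset.mem_filter, Finsupp.mem_support_iff, and_iff_right_iff_imp]
    exact fun h h0 => h (h0 ▸ p.zero_mem)
  have memT : ∀ v, v ∈ T ↔ b.repr s v ∉ p := fun v => by
    simp only [T, Finset.mem_filter, Finsupp.mem_support_iff, and_iff_right_iff_imp]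
    exact fun h h0 => h (h0 ▸ p.zero_mem)
  obtain ⟨v₀, hv₀, w₀, hw₀, huniq⟩ := UniqueSums.uniqueAdd_of_nonempty (A := S) (B := T)
    ⟨v₁, (memS _).2 hv₁⟩ ⟨w₁, (memT _).2 hw₁⟩
  have hrs : r * s = ∑ x ∈ (b.repr r).support ×ˢ (b.repr s).support,
      (b.repr r x.1 * b.repr s x.2 * c x.1 x.2) • b (x.1 + x.2) := by
    conv_lhs => rw [← b.linearCombination_repr r, ← b.linearCombination_repr s,
      Finsupp.linearCombination_apply, Finsupp.linearCombination_apply, Finsupp.sum, Finsupp.sum,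
      Finset.sum_mul_sum, ← Finset.sum_product']
    refine Finset.sum_congr rfl fun x _ => ?_
    rw [smul_mul_smul_comm, hc, smul_smul]
  have hcoef := h (v₀ + w₀)
  rw [hrs, map_sum, Finsupp.finsetSum_apply] at hcoef
  have hmem : (v₀, w₀) ∈ (b.repr r).support ×ˢ (b.repr s).support :=
    Finset.mk_mem_product (Finset.mem_filter.1 hv₀).1 (Finset.mem_filter.1 hw₀).1
  rw [← Finset.add_sum_erase _ _ hmem] at hcoef
  -- Every other pair with sum `v₀ + w₀` has a factor in `p`, by uniqueness of the sum in `S + T`.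
  have hrest : ∑ x ∈ ((b.repr r).support ×ˢ (b.repr s).support).erase (v₀, w₀),
      (b.repr ((b.repr r x.1 * b.repr s x.2 * c x.1 x.2) • b (x.1 + x.2))) (v₀ + w₀) ∈ p := by
    refine p.sum_mem fun x hx => ?_
    simp only [map_smul, Finsupp.smul_apply, Module.Basis.repr_self, Finsupp.single_apply,
      smul_eq_mul]
    split_ifs with hsum
    · by_cases h1 : b.repr r x.1 ∈ p
      · exact p.mul_mem_right _ (p.mul_mem_right _ (p.mul_mem_right _ h1))
      by_cases h2 : b.repr s x.2 ∈ p
      · exact p.mul_mem_right _ (p.mul_mem_right _ (p.mul_mem_left _ h2))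
      have := huniq ((memS _).2 h1) ((memT _).2 h2) hsum
      exact absurd (Prod.ext this.1 this.2) (Finset.ne_of_mem_erase hx)
    · simp
  have h3 := (p.add_mem_iff_left hrest).1 hcoef
  simp only [map_smul, Finsupp.smul_apply, Module.Basis.repr_self, Finsupp.single_eq_same,
    smul_eq_mul, mul_one] at h3
  rcases hp.mem_or_mem h3 with h4 | h4
  · rcases hp.mem_or_mem h4 with h5 | h5
    · exact (memS _).1 hv₀ h5
    · exact (memT _).1 hw₀ h5
  · exact hp.ne_top (p.eq_top_of_isUnit_mem h4 (c v₀ w₀).isUnit)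

theorem IsMonomialBasis.noZeroDivisors [UniqueSums ι] [IsDomain A] {b : Module.Basis ι A R}
    (hb : IsMonomialBasis b) : NoZeroDivisors R where
  eq_zero_or_eq_zero_of_mul_eq_zero {r s} h := by
    have := hb.repr_mem_of_mul (⊥ : Ideal A) (r := r) (s := s) (by simp [h])
    simp only [Ideal.mem_bot] at this
    refine this.imp (fun h => ?_) (fun h => ?_) <;>
    · apply b.repr.injective
      ext u
      simpa using h u

open Pointwise in
/-- Two linear maps that move the supports of the elements by a finite set have a nontrivial common
value. -/
theorem exists_apply_eq_apply_of_card [Nontrivial A] [DecidableEq ι] (b : Module.Basis ι A R)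
    {F B : Finset ι} (hB : (F + B).card < 2 * B.card) (L₁ L₂ : R →ₗ[A] R)
    (h₁ : ∀ v, (b.repr (L₁ (b v))).support ⊆ F + {v})
    (h₂ : ∀ v, (b.repr (L₂ (b v))).support ⊆ F + {v}) :
    ∃ s t : R, (s ≠ 0 ∨ t ≠ 0) ∧ L₁ s = L₂ t := by
  let σ : (B → A) →ₗ[A] R := Fintype.linearCombination A (fun v : B => b v)
  have hσ : Function.Injective σ :=
    linearIndependent_iff_injective_fintypeLinearCombination.1 (b.linearIndependent.comp _ Subtype.val_injective)
  -- The pairs `(s, t)` supported on `B` form a free module of rank `2|B|`, while `L₁ s - L₂ t` is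
  -- supported on `F + B`, which has fewer elements. So this map cannot be injective.
  let N : (B ⊕ B → A) →ₗ[A] R :=
    L₁ ∘ₗ σ ∘ₗ LinearMap.funLeft A A Sum.inl - L₂ ∘ₗ σ ∘ₗ LinearMap.funLeft A A Sum.inr
  let M : (B ⊕ B → A) →ₗ[A] ((F + B : Finset ι) → A) :=
    LinearMap.pi (fun u => Finsupp.lapply (u : ι) ∘ₗ b.repr.toLinearMap ∘ₗ N)
  have hsupp : ∀ (L' : R →ₗ[A] R), (∀ v, (b.repr (L' (b v))).support ⊆ F + {v}) →
      ∀ (f : B → A) (u : ι), u ∉ F + B → b.repr (L' (σ f)) u = 0 := by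
    intro L' hL' f u hu
    simp only [σ, Fintype.linearCombination_apply, map_sum, map_smul, Finsupp.finsetSum_apply,
      Finsupp.smul_apply]
    refine Finset.sum_eq_zero fun v _ => ?_
    have : u ∉ (b.repr (L' (b v))).support := fun h => hu (by
      refine Finset.add_subset_add_left ?_ (hL' v h)
      simp)
    rw [Finsupp.notMem_support_iff.1 this, smul_zero]
  have hM : ¬ Function.Injective M := fun h => by
    have := card_le_of_injective A M h
    simp only [Fintype.card_sum, Fintype.card_coe] at this
    omega
  rw [← LinearMap.ker_eq_bot, Submodule.eq_bot_iff] at hM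
  push Not at hM
  obtain ⟨f, hf, hf0⟩ := hM
  have hN : N f = 0 := by
    apply b.repr.injective
    ext u
    by_cases hu : u ∈ F + B
    · have := congrFun (LinearMap.mem_ker.1 hf) ⟨u, hu⟩
      simpa [M] using this
    · simp only [N, LinearMap.sub_apply, LinearMap.comp_apply, map_sub, Finsupp.sub_apply, map_zero,
        Finsupp.zero_apply]
      rw [hsupp L₁ h₁ _ u hu, hsupp L₂ h₂ _ u hu, sub_zero]
  refine ⟨σ (f ∘ Sum.inl), σ (f ∘ Sum.inr), ?_, sub_eq_zero.1 hN⟩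
  by_contra! hcon
  apply hf0
  have e1 := hσ (hcon.1.trans (map_zero σ).symm)
  have e2 := hσ (hcon.2.trans (map_zero σ).symm)
  ext (v | v)
  · exact congrFun e1 v
  · exact congrFun e2 v

open Pointwise in
/-- The right and the left Ore condition for the nonzero elements of an algebra with a basis of
monomials whose index monoid has subexponential growth. -/
theorem IsMonomialBasis.ore [UniqueSums ι] [IsDomain A] [DecidableEq ι] {b : Module.Basis ι A R}
    (hb : IsMonomialBasis b)
    (hι : ∀ F : Finset ι, ∃ B : Finset ι, (F + B).card < 2 * B.card) (r : R) {c : R} (hc : c ≠ 0) :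
    (∃ r' c' : R, c' ≠ 0 ∧ r * c' = c * r') ∧ (∃ r' c' : R, c' ≠ 0 ∧ c' * r = r' * c) := by
  have := hb.noZeroDivisors
  choose u hu using hb
  let F := (b.repr r).support ∪ (b.repr c).support
  obtain ⟨B, hB⟩ := hι F
  have hmul : ∀ r' v, (b.repr (r' * b v)).support ⊆ (b.repr r').support + {v} := by
    intro r' v w hw
    rw [← b.linearCombination_repr r', Finsupp.linearCombination_apply, Finsupp.sum,
      Finset.sum_mul, map_sum] at hw
    obtain ⟨x, hx, hxw⟩ := Finsupp.mem_support_finsetSum w hw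
    rw [smul_mul_assoc, hu, smul_smul, map_smul, b.repr_self, Finsupp.mem_support_iff,
      Finsupp.smul_apply, Finsupp.single_apply] at hxw
    rw [Finset.mem_add]
    refine ⟨x, by simpa using hx, v, by simp, ?_⟩
    by_contra h
    simp [h] at hxw
  have hmul' : ∀ r' v, (b.repr (b v * r')).support ⊆ (b.repr r').support + {v} := by
    intro r' v w hw
    rw [← b.linearCombination_repr r', Finsupp.linearCombination_apply, Finsupp.sum,
      Finset.mul_sum, map_sum] at hw
    obtain ⟨x, hx, hxw⟩ := Finsupp.mem_support_finsetSum w hw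
    rw [mul_smul_comm, hu, smul_smul, map_smul, b.repr_self, Finsupp.mem_support_iff,
      Finsupp.smul_apply, Finsupp.single_apply] at hxw
    rw [Finset.mem_add]
    refine ⟨x, by simpa using hx, v, by simp, ?_⟩
    by_contra h
    rw [add_comm] at h
    simp [h] at hxw
  constructor
  · obtain ⟨s, t, hst, h⟩ := exists_apply_eq_apply_of_card b hB
      (LinearMap.mulLeft A r) (LinearMap.mulLeft A c)
      (fun v => (hmul r v).trans (Finset.add_subset_add_right Finset.subset_union_left))
      (fun v => (hmul c v).trans (Finset.add_subset_add_right Finset.subset_union_right))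
    simp only [LinearMap.mulLeft_apply] at h
    -- A vanishing denominator `s` would give `ct = 0`, hence `t = 0`, against the nontriviality of
    -- the pair.
    refine ⟨t, s, fun hs => ?_, h⟩
    rw [hs, mul_zero, eq_comm, mul_eq_zero] at h
    rcases hst with h1 | h1
    · exact h1 hs
    · exact h1 (h.resolve_left hc)
  · obtain ⟨s, t, hst, h⟩ := exists_apply_eq_apply_of_card b hB
      (LinearMap.mulRight A r) (LinearMap.mulRight A c)
      (fun v => (hmul' r v).trans (Finset.add_subset_add_right Finset.subset_union_left))
      (fun v => (hmul' c v).trans (Finset.add_subset_add_right Finset.subset_union_right))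
    simp only [LinearMap.mulRight_apply] at h
    refine ⟨t, s, fun hs => ?_, h⟩
    rw [hs, zero_mul, eq_comm, mul_eq_zero] at h
    rcases hst with h1 | h1
    · exact h1 hs
    · exact h1 (h.resolve_right hc)

end TwistedBasis

/-! ### Localizations, rings of fractions and induced actions -/

namespace Loc

variable {k R E : Type*} [CommRing k] [Ring R] [Algebra k R] [Semiring E] [Algebra k E] {S : Set R}

/-- The values on the formal inverses are forced, since a left inverse equals a right inverse. -/
theorem hom_ext {f g : Loc k S →ₐ[k] E} (h : ∀ r, f (of k S r) = g (of k S r)) : f = g := by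
  refine RingQuot.ringQuot_ext' _ _ _ (FreeAlgebra.hom_ext (funext ?_))
  rintro (r | ⟨s, hs⟩)
  · exact h r
  · have hf := congrArg f (unit k hs).inv_mul
    have hg := congrArg g (unit k hs).mul_inv
    simp only [map_mul, map_one] at hf hg
    have hs' : f (unit k hs).val = g (unit k hs).val := h s
    rw [hs'] at hf
    exact left_inv_eq_right_inv hf hg

theorem isUnit_of {s : R} (hs : s ∈ S) : IsUnit (of k S s) := (unit k hs).isUnit

/-- The universal property of the localization. -/
noncomputable def lift (f : R →ₐ[k] E) (hf : ∀ s ∈ S, IsUnit (f s)) : Loc k S →ₐ[k] E :=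
  RingQuot.liftAlgHom k ⟨FreeAlgebra.lift k (Sum.elim f fun s => ((hf s s.2).unit⁻¹ : Eˣ)), by
    rintro _ _ (_ | _ | _ | s | s)
    · simp
    · simp
    · simp
    · simp only [map_mul, FreeAlgebra.lift_ι_apply, Sum.elim_inl, Sum.elim_inr, map_one]
      exact (hf s s.2).mul_val_inv
    · simp only [map_mul, FreeAlgebra.lift_ι_apply, Sum.elim_inl, Sum.elim_inr, map_one]
      exact (hf s s.2).val_inv_mul⟩

@[simp]
theorem lift_of (f : R →ₐ[k] E) (hf : ∀ s ∈ S, IsUnit (f s)) (r : R) :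
    lift f hf (of k S r) = f r := by
  have : of k S r = RingQuot.mkAlgHom k (InvertRel k S) (FreeAlgebra.ι k (Sum.inl r)) := rfl
  rw [this, lift, RingQuot.liftAlgHom_mkAlgHom_apply]
  simp

/-- Localization at an Ore set of regular elements gives the ring of fractions. -/
theorem isRingOfFractions [NoZeroDivisors R] [Nontrivial R] (T : Submonoid R)
    (hTS : (T : Set R) = S) (h0 : (0 : R) ∉ T)
    (hr : ∀ r : R, ∀ c ∈ T, ∃ r', ∃ c' ∈ T, r * c' = c * r')
    (hl : ∀ r : R, ∀ c ∈ T, ∃ r', ∃ c' ∈ T, c' * r = r' * c) :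
    IsRingOfFractions S (of k S).toRingHom := by
  subst hTS
  have hT : T ≤ nonZeroDivisors R := le_nonZeroDivisors_of_noZeroDivisors h0
  choose! n d hd hnd using hl
  let _ : OreLocalization.OreSet T :=
    { ore_right_cancel := fun r₁ r₂ s h => ⟨1, by
        rw [mul_cancel_right_mem_nonZeroDivisors (hT s.2)] at h; rw [h]⟩
      oreNum := fun r s => n r s
      oreDenom := fun r s => ⟨d r s, hd r s s.2⟩
      ore_eq := fun r s => hnd r s s.2 }
  let num : R →ₐ[k] OreLocalization T R :=
    { OreLocalization.numeratorHom with
      map_zero' := OreLocalization.zero_oreDiv' 1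
      map_add' := fun a b => OreLocalization.add_oreDiv.symm
      commutes' := fun r => rfl }
  let φ : Loc k (T : Set R) →ₐ[k] OreLocalization T R :=
    lift num (fun s hs => OreLocalization.numerator_isUnit ⟨s, hs⟩)
  have hφ : ∀ r, φ (of k _ r) = num r := fun r => lift_of _ _ r
  let ofT : T →* (Loc k (T : Set R))ˣ :=
    { toFun := fun s => unit k s.2
      map_one' := Units.ext (map_one (of k (T : Set R)))
      map_mul' := fun a b => Units.ext (map_mul (of k (T : Set R)) (a : R) (b : R)) }
  -- The comparison `φ` gives injectivity of `R → Loc`. The identity `ψ ∘ φ = id` alone suffices to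
  -- carry left fractions from the Ore localization to `Loc`.
  let ψ : OreLocalization T R →+* Loc k (T : Set R) :=
    OreLocalization.universalHom (of k (T : Set R)).toRingHom ofT (fun s => rfl)
  have hψnum : ∀ r, ψ (num r) = of k (T : Set R) r := fun r =>
    OreLocalization.universalHom_commutes _ _ (fun s => rfl)
  let ψ' : OreLocalization T R →ₐ[k] Loc k (T : Set R) :=
    { ψ with
      commutes' := fun r => by
        have := hψnum (algebraMap k R r)
        rw [AlgHom.commutes, AlgHom.commutes] at this
        exact this }
  have hψφ : ψ'.comp φ = AlgHom.id k _ := hom_ext fun r => by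
    simp only [AlgHom.comp_apply, hφ, AlgHom.id_apply]
    exact hψnum r
  have left : ∀ q : Loc k (T : Set R), ∃ r : R, ∃ s ∈ (T : Set R), of k _ s * q = of k _ r := by
    intro q
    have hq : ψ (φ q) = q := DFunLike.congr_fun hψφ q
    generalize φ q = x at hq
    induction x with | _ r s
    refine ⟨r, s, s.2, ?_⟩
    rw [← hq]
    exact (Units.mul_inv_cancel_left (unit k s.2) _)
  refine ⟨fun a b hab => ?_, fun s hs => (unit k hs).isUnit, fun q => ?_, left⟩
  · have h1 : num a = num b := by rw [← hφ, ← hφ]; exact congrArg φ hab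
    exact OreLocalization.numeratorHom_inj (fun x hx => (hT hx).1) h1
  -- The right Ore condition turns the left fraction `s⁻¹r` into a right fraction `r's'⁻¹`.
  · obtain ⟨r, s, hs, hq⟩ := left q
    obtain ⟨r', s', hs', h⟩ := hr r s hs
    refine ⟨r', s', hs', ?_⟩
    apply (unit k hs).isUnit.mul_left_cancel
    change of k _ s * (q * of k _ s') = of k _ s * of k _ r'
    rw [← mul_assoc, hq, ← map_mul, ← map_mul, h]

end Loc

/-- The group homomorphism to the automorphism group that underlies an action by endomorphisms. -/
noncomputable def algAut {k E Γ : Type*} [CommRing k] [Semiring E] [Algebra k E] [Group Γ]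
    (f : Γ →* (E →ₐ[k] E)) : Γ →* (E ≃ₐ[k] E) :=
  (AlgEquiv.algHomUnitsEquiv k E).toMonoidHom.comp f.toHomUnits

/-- The endomorphism of the localization induced by an endomorphism that preserves `S`. -/
noncomputable def Loc.map {k R : Type*} [CommRing k] [Ring R] [Algebra k R] {S : Set R}
    (f : R →ₐ[k] R) (hf : ∀ s ∈ S, f s ∈ S) : Loc k S →ₐ[k] Loc k S :=
  Loc.lift (E := Loc k S) ((Loc.of k S).comp f) (fun s hs => Loc.isUnit_of (hf s hs))

theorem Loc.map_of {k R : Type*} [CommRing k] [Ring R] [Algebra k R] {S : Set R}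
    (f : R →ₐ[k] R) (hf : ∀ s ∈ S, f s ∈ S) (r : R) :
    Loc.map f hf (Loc.of k S r) = Loc.of k S (f r) :=
  Loc.lift_of (E := Loc k S) ((Loc.of k S).comp f) (fun s hs => Loc.isUnit_of (hf s hs)) r

/-- A group action on `R` that preserves `S` induces an action on the localization. -/
noncomputable def Loc.action {k R Γ : Type*} [CommRing k] [Ring R] [Algebra k R] [Group Γ]
    {S : Set R} (ρ : Γ →* (R →ₐ[k] R)) (hρ : ∀ g, ∀ s ∈ S, ρ g s ∈ S) :
    Γ →* (Loc k S →ₐ[k] Loc k S) where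
  toFun g := Loc.map (ρ g) (hρ g)
  map_one' := Loc.hom_ext fun r => by rw [Loc.map_of, map_one]; rfl
  map_mul' g h := Loc.hom_ext fun r => by
    rw [AlgHom.mul_apply, Loc.map_of, Loc.map_of, Loc.map_of, map_mul]; rfl

theorem Loc.action_of {k R Γ : Type*} [CommRing k] [Ring R] [Algebra k R] [Group Γ]
    {S : Set R} (ρ : Γ →* (R →ₐ[k] R)) (hρ : ∀ g, ∀ s ∈ S, ρ g s ∈ S) (g : Γ) (r : R) :
    Loc.action ρ hρ g (Loc.of k S r) = Loc.of k S (ρ g r) :=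
  Loc.map_of (ρ g) (hρ g) r

/-! ### Normalized monomials and the symplectic action of `SL₂(ℤ)` -/

/-- The standard symplectic form on `ℤ × ℤ`. -/
def symp (v w : ℤ × ℤ) : ℤ := v.2 * w.1 - v.1 * w.2

section Group

variable {Γ : Type*} [Group Γ]

/-- The relations of a quantum torus, for `z = Z` and `xy = z²yx`. -/
structure QCommute (X Y Z : Γ) : Prop where
  xz : Commute X Z
  yz : Commute Y Z
  xy : X * Y = Z ^ 2 * Y * X

/-- The normalized monomial `Z^{ac} Y^a X^c` for `v = (a, c)`. -/
def qmon (X Y Z : Γ) (v : ℤ × ℤ) : Γ := Z ^ (v.1 * v.2) * Y ^ v.1 * X ^ v.2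

theorem map_qmon {Γ' : Type*} [Group Γ'] (f : Γ →* Γ') (X Y Z : Γ) (v : ℤ × ℤ) :
    f (qmon X Y Z v) = qmon (f X) (f Y) (f Z) v := by
  simp [qmon]

theorem QCommute.commute_qmon {X Y Z : Γ} (h : QCommute X Y Z) (v : ℤ × ℤ) :
    Commute Z (qmon X Y Z v) :=
  (((Commute.refl Z).zpow_right _).mul_right (h.yz.symm.zpow_right _)).mul_right
    (h.xz.symm.zpow_right _)

/-- The relation is a semiconjugation, so it passes to integer powers of `Y` first and then of `X`.
-/
theorem QCommute.zpow_mul_zpow {X Y Z : Γ} (h : QCommute X Y Z) (m n : ℤ) :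
    X ^ m * Y ^ n = Z ^ (2 * (m * n)) * (Y ^ n * X ^ m) := by
  have h1 : SemiconjBy X Y (Z ^ 2 * Y) := h.xy
  have h2 : X * Y ^ n = Z ^ (2 * n) * Y ^ n * X := by
    have := (h1.zpow_right n).eq
    rwa [(h.yz.symm.pow_left 2).mul_zpow, ← zpow_natCast, ← zpow_mul] at this
  have h3 : SemiconjBy (Y ^ n) X (Z ^ (-(2 * n)) * X) := by
    have h4 : Commute (Y ^ n) (Z ^ (2 * n)) := (h.yz.zpow_left n).zpow_right _
    change Y ^ n * X = Z ^ (-(2 * n)) * X * Y ^ n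
    rw [mul_assoc, h2, zpow_neg, mul_assoc, inv_mul_cancel_left]
  have h5 := (h3.zpow_right m).eq
  rw [(h.xz.symm.zpow_left _).mul_zpow, ← zpow_mul] at h5
  rw [h5, mul_assoc, ← mul_assoc, ← zpow_add]
  have : 2 * (m * n) + -(2 * n) * m = 0 := by ring
  rw [this, zpow_zero, one_mul]

/-- The factor `Z^{ac}` is chosen for this rule: moving `X^c` past `Y^{a'}` costs the exponent
`2ca'`, which is not alternating, and the normalization replaces it by `ca' - ac'`. -/
theorem QCommute.qmon_mul {X Y Z : Γ} (h : QCommute X Y Z) (v w : ℤ × ℤ) :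
    qmon X Y Z v * qmon X Y Z w = Z ^ symp v w * qmon X Y Z (v + w) := by
  have hX : ∀ m n : ℤ, X ^ m * Z ^ n = Z ^ n * X ^ m := fun m n =>
    ((h.xz.zpow_left m).zpow_right n).eq
  have hY : ∀ m n : ℤ, Y ^ m * Z ^ n = Z ^ n * Y ^ m := fun m n =>
    ((h.yz.zpow_left m).zpow_right n).eq
  obtain ⟨a, c⟩ := v
  obtain ⟨a', c'⟩ := w
  simp only [qmon, symp, Prod.mk_add_mk]
  calc Z ^ (a * c) * Y ^ a * X ^ c * (Z ^ (a' * c') * Y ^ a' * X ^ c')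
      = Z ^ (a * c) * Y ^ a * (X ^ c * Z ^ (a' * c')) * Y ^ a' * X ^ c' := by
        simp only [mul_assoc]
    _ = Z ^ (a * c) * (Y ^ a * Z ^ (a' * c')) * (X ^ c * Y ^ a') * X ^ c' := by
        rw [hX]; simp only [mul_assoc]
    _ = Z ^ (a * c) * Z ^ (a' * c') * (Y ^ a * Z ^ (2 * (c * a'))) * Y ^ a' * X ^ c * X ^ c' := by
        rw [hY, h.zpow_mul_zpow]; simp only [mul_assoc]
    _ = Z ^ (a * c) * Z ^ (a' * c') * Z ^ (2 * (c * a')) * (Y ^ a * Y ^ a') * (X ^ c * X ^ c') := by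
        rw [hY]; simp only [mul_assoc]
    _ = _ := by
        simp only [← mul_assoc, ← zpow_add]
        congr 3
        ring

/-- A family with the multiplication rule of the normalized monomials consists of the normalized
monomials. -/
theorem qmon_of_mul {Z : Γ} {E : ℤ × ℤ → Γ} (hZ : ∀ v, Commute Z (E v))
    (hE : ∀ v w, E v * E w = Z ^ symp v w * E (v + w)) :
    QCommute (E (0, 1)) (E (1, 0)) Z ∧ ∀ v, qmon (E (0, 1)) (E (1, 0)) Z v = E v := by
  have h0 : E 0 = 1 := by
    have := hE 0 0
    simpa [symp] using this
  -- The form is alternating, so there is no twist along a line.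
  have hpow : ∀ v (n : ℤ), E v ^ n = E (n • v) := by
    intro v n
    have hs : ∀ m l : ℤ, E (m • v) * E (l • v) = E ((m + l) • v) := fun m l => by
      rw [hE, add_smul]
      have : symp (m • v) (l • v) = 0 := by simp [symp]; ring
      rw [this, zpow_zero, one_mul]
    induction n with
    | zero => simp [h0]
    | succ n ih => rw [zpow_add_one, ih, ← hs, one_smul]
    | pred n ih =>
      rw [zpow_sub_one, ih, sub_eq_add_neg, ← hs]
      congr 1
      rw [inv_eq_iff_mul_eq_one]
      nth_rewrite 1 [← one_smul ℤ v]
      rw [hs]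
      simp [h0]
  constructor
  · refine ⟨(hZ _).symm, (hZ _).symm, ?_⟩
    rw [mul_assoc, hE, hE, ← mul_assoc, ← zpow_natCast, ← zpow_add]
    simp [symp]
  · rintro ⟨a, c⟩
    simp only [qmon]
    rw [hpow, hpow, mul_assoc, hE, ← mul_assoc, ← zpow_add]
    simp [symp]

/-- The natural action of `SL₂(ℤ)` on `ℤ × ℤ`. -/
def slAct (g : Matrix.SpecialLinearGroup (Fin 2) ℤ) (v : ℤ × ℤ) : ℤ × ℤ :=
  (g 0 0 * v.1 + g 0 1 * v.2, g 1 0 * v.1 + g 1 1 * v.2)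

theorem slAct_add (g : Matrix.SpecialLinearGroup (Fin 2) ℤ) (v w : ℤ × ℤ) :
    slAct g (v + w) = slAct g v + slAct g w := by
  ext <;> simp [slAct] <;> ring

theorem slAct_mul (g h : Matrix.SpecialLinearGroup (Fin 2) ℤ) (v : ℤ × ℤ) :
    slAct (g * h) v = slAct g (slAct h v) := by
  ext <;> simp [slAct, Matrix.mul_apply, Fin.sum_univ_two] <;> ring

/-- A linear map scales the form by its determinant. -/
theorem symp_slAct (g : Matrix.SpecialLinearGroup (Fin 2) ℤ) (v w : ℤ × ℤ) :
    symp (slAct g v) (slAct g w) = symp v w := by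
  have h := g.det_coe
  rw [Matrix.det_fin_two] at h
  simp only [symp, slAct]
  linear_combination (v.2 * w.1 - v.1 * w.2) * h

/-- Invariance of the form makes `v ↦ qmon (g v)` obey the same multiplication rule, and that rule
alone determines the family from its values at `(0, 1)` and `(1, 0)`. This yields both the
endomorphism attached to `g` and its effect on all monomials. -/
theorem QCommute.slAct {X Y Z : Γ} (h : QCommute X Y Z)
    (g : Matrix.SpecialLinearGroup (Fin 2) ℤ) :
    QCommute (qmon X Y Z (slAct g (0, 1))) (qmon X Y Z (slAct g (1, 0))) Z ∧
      ∀ v, qmon (qmon X Y Z (_root_.slAct g (0, 1))) (qmon X Y Z (_root_.slAct g (1, 0))) Z v =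
        qmon X Y Z (_root_.slAct g v) :=
  qmon_of_mul (E := fun v => qmon X Y Z (_root_.slAct g v)) (fun _ => h.commute_qmon _)
    fun v w => by rw [h.qmon_mul, symp_slAct, slAct_add]

end Group

/-! ### The representation by shift operators -/

section Representation

variable {A : Type*} [CommRing A] (u : Aˣ)

/-- The operator `e_w ↦ u^{⟨v, w⟩} e_{v + w}` on the free module with basis `ℤ × ℤ`. -/
noncomputable def shiftOp (v : ℤ × ℤ) : Module.End A (ℤ × ℤ →₀ A) :=
  Finsupp.lsum A fun w => ((u ^ symp v w : Aˣ) : A) • Finsupp.lsingle (v + w)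

theorem shiftOp_single (v w : ℤ × ℤ) (a : A) :
    shiftOp u v (Finsupp.single w a) = Finsupp.single (v + w) (((u ^ symp v w : Aˣ) : A) * a) := by
  simp [shiftOp]

/-- Bilinearity makes `symp` a 2-cocycle: `ω(w,x) + ω(v,w+x) = ω(v,w) + ω(v+w,x)`. -/
theorem shiftOp_mul (v w : ℤ × ℤ) :
    shiftOp u v * shiftOp u w = ((u ^ symp v w : Aˣ) : A) • shiftOp u (v + w) := by
  refine Finsupp.lhom_ext fun x a => ?_
  rw [Module.End.mul_apply, LinearMap.smul_apply, shiftOp_single, shiftOp_single, shiftOp_single,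
    Finsupp.smul_single, smul_eq_mul, ← mul_assoc, ← mul_assoc, ← Units.val_mul, ← Units.val_mul,
    ← zpow_add, ← zpow_add, add_assoc]
  congr 4
  simp only [symp, Prod.fst_add, Prod.snd_add]
  ring

theorem shiftOp_zero : shiftOp u 0 = 1 := by
  refine Finsupp.lhom_ext fun x a => ?_
  simp [shiftOp_single, symp]

/-- `shiftOp` as a unit. -/
noncomputable def shiftUnit (v : ℤ × ℤ) : (Module.End A (ℤ × ℤ →₀ A))ˣ where
  val := shiftOp u v
  inv := shiftOp u (-v)
  val_inv := by
    have : symp v (-v) = 0 := by simp [symp]; ring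
    simp [shiftOp_mul, this, shiftOp_zero]
  inv_val := by
    have : symp (-v) v = 0 := by simp [symp]; ring
    simp [shiftOp_mul, this, shiftOp_zero]

/-- Multiplication by `u` as a unit of the endomorphism ring. -/
noncomputable def scalarUnit : (Module.End A (ℤ × ℤ →₀ A))ˣ :=
  Units.map (algebraMap A (Module.End A (ℤ × ℤ →₀ A))).toMonoidHom u

theorem shiftUnit_spec :
    QCommute (shiftUnit u (0, 1)) (shiftUnit u (1, 0)) (scalarUnit u) ∧
      ∀ v, qmon (shiftUnit u (0, 1)) (shiftUnit u (1, 0)) (scalarUnit u) v = shiftUnit u v :=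
  qmon_of_mul (fun v => Units.ext (Algebra.commutes _ _)) fun v w => Units.ext (by
    have := shiftOp_mul u v w
    rw [Algebra.smul_def] at this
    rw [scalarUnit, ← map_zpow]
    exact this)

end Representation

/-! ### Ideals, height one primes and fractions of a quantum torus -/

section QuantumTorus

variable {A R : Type*} [CommRing A] [Ring R] [Algebra A R]

/-- `b` is a basis of normalized monomials of a quantum torus with parameter `u`. -/
def IsTorusBasis (b : Module.Basis (ℤ × ℤ) A R) (u : Aˣ) : Prop :=
  ∀ v w, b v * b w = ((u ^ symp v w : Aˣ) : A) • b (v + w)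

variable {b : Module.Basis (ℤ × ℤ) A R} {u : Aˣ}

namespace IsTorusBasis

theorem isMonomialBasis (h : IsTorusBasis b u) : IsMonomialBasis b := fun v w => ⟨_, h v w⟩

theorem zero_eq_one (h : IsTorusBasis b u) : b 0 = 1 := by
  have h1 : LinearMap.mulLeft A (b 0) = LinearMap.id := b.ext fun v => by
    simp [h 0 v, symp]
  simpa using DFunLike.congr_fun h1 1

theorem mul_neg (h : IsTorusBasis b u) (v : ℤ × ℤ) : b v * b (-v) = 1 := by
  have : symp v (-v) = 0 := by simp [symp]; ring
  rw [h, this, add_neg_cancel, h.zero_eq_one, zpow_zero, Units.val_one, one_smul]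

/-- Monomials are eigenvectors of conjugation by `b w`, with eigenvalue `u^{2ω(w,v)}` on `b v`. This
is the tool for separating the terms of an element of an ideal. -/
theorem repr_conj (h : IsTorusBasis b u) (w v : ℤ × ℤ) (r : R) :
    b.repr (b w * r * b (-w)) v = ((u ^ (2 * symp w v) : Aˣ) : A) * b.repr r v := by
  have h1 : (Finsupp.lapply v ∘ₗ b.repr.toLinearMap) ∘ₗ
      LinearMap.mulRight A (b (-w)) ∘ₗ LinearMap.mulLeft A (b w) =
      ((u ^ (2 * symp w v) : Aˣ) : A) • (Finsupp.lapply v ∘ₗ b.repr.toLinearMap) := b.ext fun v' => by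
    have e : w + v' + -w = v' := by abel
    have e2 : symp w v' + symp (w + v') (-w) = 2 * symp w v' := by simp [symp]; ring
    simp only [LinearMap.comp_apply, LinearMap.mulLeft_apply, LinearMap.mulRight_apply, h w v',
      h (w + v') (-w), smul_smul, LinearMap.smul_apply, e, ← Units.val_mul,
      ← zpow_add, e2, LinearEquiv.coe_coe, map_smul, b.repr_self, Finsupp.lapply_apply,
      Finsupp.single_apply, smul_eq_mul]
    split_ifs with hv
    · rw [hv]
    · simp
  exact DFunLike.congr_fun h1 r

/-- A nonzero ideal of a quantum torus, at a parameter that is not a root of unity, meets the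
ground ring. -/
theorem exists_algebraMap_mem [IsDomain A] (h : IsTorusBasis b u) (hu : ∀ n : ℤ, n ≠ 0 → u ^ n ≠ 1)
    (P : TwoSidedIdeal R) (hP : P ≠ ⊥) : ∃ a : A, a ≠ 0 ∧ algebraMap A R a ∈ P := by
  -- Induction on the number of terms: an element with one term is a scalar up to a monomial unit,
  -- and a longer one can be shortened inside `P`.
  have key : ∀ n : ℕ, ∀ r ∈ P, r ≠ 0 → (b.repr r).support.card = n →
      ∃ a : A, a ≠ 0 ∧ algebraMap A R a ∈ P := by
    intro n
    induction n using Nat.strong_induction_on with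
    | _ n ih =>
    intro r hr hr0 hn
    obtain ⟨v₀, hv₀⟩ : (b.repr r).support.Nonempty := by
      rw [Finsupp.support_nonempty_iff]
      exact fun h0 => hr0 (b.repr.map_eq_zero_iff.1 h0)
    by_cases hone : (b.repr r).support = {v₀}
    · refine ⟨b.repr r v₀, Finsupp.mem_support_iff.1 hv₀, ?_⟩
      have h1 : r = b.repr r v₀ • b v₀ := by
        conv_lhs => rw [← b.linearCombination_repr r, Finsupp.linearCombination_apply, Finsupp.sum,
          hone, Finset.sum_singleton]
      have h2 : r * b (-v₀) = algebraMap A R (b.repr r v₀) := by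
        conv_lhs => rw [h1, smul_mul_assoc, h.mul_neg]
        rw [Algebra.algebraMap_eq_smul_one]
      rw [← h2]
      exact P.mul_mem_right _ _ hr
    · obtain ⟨v₁, hv₁, hne⟩ : ∃ v₁ ∈ (b.repr r).support, v₁ ≠ v₀ := by
        by_contra! hcon
        exact hone (Finset.eq_singleton_iff_unique_mem.2 ⟨hv₀, hcon⟩)
      -- This is `v₁ - v₀` rotated by a right angle, so that `ω(w, v₁ - v₀)` is the squared length
      -- of `v₁ - v₀`.
      let w : ℤ × ℤ := (-(v₁.2 - v₀.2), v₁.1 - v₀.1)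
      have hw : symp w v₁ - symp w v₀ ≠ 0 := by
        have h1 : symp w v₁ - symp w v₀ = (v₁.1 - v₀.1) ^ 2 + (v₁.2 - v₀.2) ^ 2 := by
          simp only [symp, w]; ring
        rw [h1]
        intro h2
        have h3 : v₁.1 - v₀.1 = 0 := by nlinarith [sq_nonneg (v₁.1 - v₀.1), sq_nonneg (v₁.2 - v₀.2)]
        have h4 : v₁.2 - v₀.2 = 0 := by nlinarith [sq_nonneg (v₁.1 - v₀.1), sq_nonneg (v₁.2 - v₀.2)]
        exact hne (Prod.ext (sub_eq_zero.1 h3) (sub_eq_zero.1 h4))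
      -- Subtracting the eigenvalue at `v₀` kills the term at `v₀`, and the term at `v₁` survives
      -- because its eigenvalue differs.
      let s := b w * r * b (-w) - ((u ^ (2 * symp w v₀) : Aˣ) : A) • r
      have hs : s ∈ P := by
        refine P.sub_mem (P.mul_mem_right _ _ (P.mul_mem_left _ _ hr)) ?_
        rw [Algebra.smul_def]
        exact P.mul_mem_left _ _ hr
      have hcoef : ∀ v, b.repr s v =
          (((u ^ (2 * symp w v) : Aˣ) : A) - ((u ^ (2 * symp w v₀) : Aˣ) : A)) * b.repr r v := by
        intro v
        simp only [s, map_sub, map_smul, Finsupp.sub_apply, h.repr_conj, Finsupp.smul_apply,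
          smul_eq_mul]
        ring
      refine ih _ ?_ s hs ?_ rfl
      · rw [← hn]
        refine Finset.card_lt_card (Finset.ssubset_iff_subset_ne.2 ⟨fun v hv => ?_, fun heq => ?_⟩)
        · rw [Finsupp.mem_support_iff, hcoef] at hv
          exact Finsupp.mem_support_iff.2 (right_ne_zero_of_mul hv)
        · rw [← heq, Finsupp.mem_support_iff, hcoef] at hv₀
          simp at hv₀
      · intro h0
        have h1 := hcoef v₁
        rw [h0, map_zero, Finsupp.zero_apply, eq_comm, mul_eq_zero] at h1
        rcases h1 with h1 | h1
        · apply hu (2 * (symp w v₁ - symp w v₀)) (mul_ne_zero two_ne_zero hw)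
          rw [mul_sub, zpow_sub, Units.ext (sub_eq_zero.1 h1), mul_inv_cancel]
        · exact Finsupp.mem_support_iff.1 hv₁ h1
  obtain ⟨r, hr, hr0⟩ : ∃ r ∈ P, r ≠ 0 := by
    by_contra! hcon
    exact hP (TwoSidedIdeal.ext fun x => ⟨fun hx => hcon x hx, fun hx => by
      rw [(TwoSidedIdeal.mem_bot R).1 hx]; exact P.zero_mem⟩)
  exact key _ r hr hr0 rfl

end IsTorusBasis

/-- The two-sided ideal `f R` generated by a scalar. -/
def scalarIdeal (A R : Type*) [CommRing A] [Ring R] [Algebra A R] (f : A) : TwoSidedIdeal R :=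
  TwoSidedIdeal.mk' {r | ∃ s : R, r = f • s} ⟨0, by simp⟩
    (by rintro _ _ ⟨s, rfl⟩ ⟨t, rfl⟩; exact ⟨s + t, by simp⟩)
    (by rintro _ ⟨s, rfl⟩; exact ⟨-s, by simp⟩)
    (by rintro x _ ⟨s, rfl⟩; exact ⟨x * s, by simp⟩)
    (by rintro _ y ⟨s, rfl⟩; exact ⟨s * y, by simp⟩)

theorem mem_scalarIdeal {f : A} {r : R} : r ∈ scalarIdeal A R f ↔ ∃ s : R, r = f • s :=
  TwoSidedIdeal.mem_mk' ..

theorem Module.Basis.mem_scalarIdeal_iff {ι : Type*} (b : Module.Basis ι A R) {f : A} {r : R} :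
    r ∈ scalarIdeal A R f ↔ ∀ v, f ∣ b.repr r v := by
  rw [mem_scalarIdeal]
  constructor
  · rintro ⟨s, rfl⟩ v
    simp
  · intro h
    choose g hg using h
    refine ⟨∑ v ∈ (b.repr r).support, g v • b v, ?_⟩
    conv_lhs => rw [← b.linearCombination_repr r, Finsupp.linearCombination_apply, Finsupp.sum]
    rw [Finset.smul_sum]
    exact Finset.sum_congr rfl fun v _ => by rw [smul_smul, ← hg]

namespace IsTorusBasis

variable (h : IsTorusBasis b u)

include h

/-- Gauss's lemma for the prime ideal `(f)` of `A`: the ideal `fR` is completely prime. -/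
theorem mem_or_mem_scalarIdeal {f : A} (hf : Prime f) {r s : R} (hrs : r * s ∈ scalarIdeal A R f) :
    r ∈ scalarIdeal A R f ∨ s ∈ scalarIdeal A R f := by
  have : (Ideal.span {f}).IsPrime := (Ideal.span_singleton_prime hf.ne_zero).2 hf
  simp only [b.mem_scalarIdeal_iff, ← Ideal.mem_span_singleton] at hrs ⊢
  exact h.isMonomialBasis.repr_mem_of_mul _ hrs

theorem algebraMap_mem_scalarIdeal {f a : A} : algebraMap A R a ∈ scalarIdeal A R f ↔ f ∣ a := by
  constructor
  · intro ha
    have := b.mem_scalarIdeal_iff.1 ha 0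
    simpa [Algebra.algebraMap_eq_smul_one, ← h.zero_eq_one] using this
  · rintro ⟨c, rfl⟩
    exact mem_scalarIdeal.2 ⟨algebraMap A R c, by rw [map_mul, Algebra.smul_def]⟩

theorem one_notMem_scalarIdeal {f : A} (hf : Prime f) : (1 : R) ∉ scalarIdeal A R f := by
  rw [← map_one (algebraMap A R), h.algebraMap_mem_scalarIdeal]
  exact hf.not_dvd_one

theorem isPrime_scalarIdeal {f : A} (hf : Prime f) : IsPrimeTwoSided (scalarIdeal A R f) :=
  ⟨fun ht => h.one_notMem_scalarIdeal hf (ht ▸ TwoSidedIdeal.mem_top R), fun a c hac =>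
    h.mem_or_mem_scalarIdeal hf (by simpa using hac 1)⟩

theorem isPrime_bot [IsDomain A] : IsPrimeTwoSided (⊥ : TwoSidedIdeal R) := by
  have := h.isMonomialBasis.noZeroDivisors
  have : Nontrivial R := b.repr.toEquiv.nontrivial
  refine ⟨bot_ne_top, fun a c hac => ?_⟩
  simpa [TwoSidedIdeal.mem_bot] using hac 1

theorem scalarIdeal_ne_bot [IsDomain A] {f : A} (hf : Prime f) : scalarIdeal A R f ≠ ⊥ := by
  intro h0
  have h1 : algebraMap A R f ∈ scalarIdeal A R f := h.algebraMap_mem_scalarIdeal.2 dvd_rfl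
  rw [h0, TwoSidedIdeal.mem_bot, Algebra.algebraMap_eq_smul_one, ← h.zero_eq_one] at h1
  have := congrArg (fun r => b.repr r 0) h1
  simp at this
  exact hf.ne_zero this

/-- A nonzero prime ideal contains a prime scalar. -/
theorem exists_scalarIdeal_le [IsDomain A] [IsPrincipalIdealRing A]
    (hu : ∀ n : ℤ, n ≠ 0 → u ^ n ≠ 1) {P : TwoSidedIdeal R} (hP : IsPrimeTwoSided P) (h0 : P ≠ ⊥) :
    ∃ f : A, Prime f ∧ scalarIdeal A R f ≤ P := by
  obtain ⟨a, ha0, ha⟩ := h.exists_algebraMap_mem hu P h0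
  -- The contraction of `P` to the central subring is a nonzero prime ideal of a PID; its generator
  -- is the required prime.
  let I : Ideal A :=
    { carrier := {a | algebraMap A R a ∈ P}
      add_mem' := fun hx hy => by
        simp only [Set.mem_ofPred_eq, map_add] at *
        exact P.add_mem hx hy
      zero_mem' := by simp
      smul_mem' := fun c x hx => by
        simp only [Set.mem_ofPred_eq, smul_eq_mul, map_mul] at *
        exact P.mul_mem_left _ _ hx }
  have hI0 : I ≠ ⊥ := fun hI => ha0 (by
    have : a ∈ I := ha
    rwa [hI, Ideal.mem_bot] at this)
  have hI : I.IsPrime := by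
    refine ⟨fun hI => hP.1 ?_, fun {x y} hxy => ?_⟩
    · have h1 : (1 : A) ∈ I := hI ▸ Submodule.mem_top
      have h2 : algebraMap A R 1 ∈ P := h1
      rw [map_one] at h2
      exact (TwoSidedIdeal.one_mem_iff P).1 h2
    · have hxy' : algebraMap A R (x * y) ∈ P := hxy
      refine hP.2 _ _ fun r => ?_
      rw [mul_assoc, ← Algebra.commutes y r, ← mul_assoc, ← map_mul]
      exact P.mul_mem_right _ _ hxy'
  refine ⟨Submodule.IsPrincipal.generator I,
    Submodule.IsPrincipal.prime_generator_of_isPrime I hI0, fun r hr => ?_⟩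
  obtain ⟨s, rfl⟩ := mem_scalarIdeal.1 hr
  rw [Algebra.smul_def]
  exact P.mul_mem_right _ _ (Submodule.IsPrincipal.generator_mem I)

/-- The prime ideals of height one are those generated by the prime scalars. -/
theorem height_eq_one_iff [IsDomain A] [IsPrincipalIdealRing A] (hu : ∀ n : ℤ, n ≠ 0 → u ^ n ≠ 1)
    (P : PrimeTwoSided R) :
    Order.height P = 1 ↔ ∃ f : A, Prime f ∧ P.1 = scalarIdeal A R f := by
  have hbot : ∀ Q : PrimeTwoSided R, Q.1 ≠ ⊥ → (⟨⊥, h.isPrime_bot⟩ : PrimeTwoSided R) < Q :=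
    fun Q hQ => Subtype.coe_lt_coe.1 (bot_lt_iff_ne_bot.2 hQ)
  constructor
  · intro hP
    have hP0 : P.1 ≠ ⊥ := by
      intro h0
      have : IsMin P := fun Q _ => Subtype.coe_le_coe.1 (h0 ▸ bot_le)
      rw [Order.height_eq_zero.2 this] at hP
      exact zero_ne_one hP
    obtain ⟨f, hf, hle⟩ := h.exists_scalarIdeal_le hu P.2 hP0
    -- A strict inclusion would give the chain `0 < fR < P`, of length two.
    refine ⟨f, hf, (hle.eq_of_not_lt fun hlt => ?_).symm⟩
    have : 1 < Order.height P := Order.one_lt_height_iff.2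
      ⟨⟨_, h.isPrime_scalarIdeal hf⟩, _, hbot _ (h.scalarIdeal_ne_bot hf), hlt⟩
    exact this.ne' hP
  · rintro ⟨f, hf, hPf⟩
    refine le_antisymm (not_lt.1 fun hlt => ?_) ?_
    · obtain ⟨Q, Q', hQ', hQ⟩ := Order.one_lt_height_iff.1 hlt
      have hQ0 : Q.1 ≠ ⊥ := fun h0 => not_lt_bot (h0 ▸ Subtype.coe_lt_coe.2 hQ')
      -- A nonzero prime `Q` below `fR` contains some `gR`. Then `f` divides `g`, so the two primes
      -- are associated and `Q` is not smaller than `fR`.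
      obtain ⟨g, hg, hle⟩ := h.exists_scalarIdeal_le hu Q.2 hQ0
      have hgQ : algebraMap A R g ∈ Q.1 := hle (h.algebraMap_mem_scalarIdeal.2 dvd_rfl)
      have hgf : algebraMap A R g ∈ scalarIdeal A R f := hPf ▸ hQ.le hgQ
      have hass := (hf.associated_of_dvd hg (h.algebraMap_mem_scalarIdeal.1 hgf)).symm
      refine hQ.not_ge (?_ : P.1 ≤ Q.1)
      rw [hPf]
      refine le_trans (fun r hr => ?_) hle
      rw [b.mem_scalarIdeal_iff] at hr ⊢
      exact fun v => hass.dvd.trans (hr v)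
    · rw [Order.one_le_iff_ne_zero, Order.height_ne_zero]
      exact fun hmin => (hmin.not_lt (hbot P (hPf ▸ h.scalarIdeal_ne_bot hf)))

/-- Since each height one prime `fR` is completely prime, an element is regular modulo it as soon as
it lies outside it. The set `𝒞` thus consists of the elements without a prime scalar factor. -/
theorem mem_heightOneRegular_iff [IsDomain A] [IsPrincipalIdealRing A]
    (hu : ∀ n : ℤ, n ≠ 0 → u ^ n ≠ 1) (c : R) :
    c ∈ heightOneRegular R ↔ ∀ f : A, Prime f → c ∉ scalarIdeal A R f := by
  constructor
  · intro hc f hf hcf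
    have := hc ⟨_, h.isPrime_scalarIdeal hf⟩ ((h.height_eq_one_iff hu _).2 ⟨f, hf, rfl⟩) 1
    exact h.one_notMem_scalarIdeal hf (this.1 (by simpa using hcf))
  · intro hc P hP r
    obtain ⟨f, hf, hPf⟩ := (h.height_eq_one_iff hu P).1 hP
    rw [hPf]
    exact ⟨fun hr => (h.mem_or_mem_scalarIdeal hf hr).resolve_left (hc f hf),
      fun hr => (h.mem_or_mem_scalarIdeal hf hr).resolve_right (hc f hf)⟩

/-- The elements of `R` that are regular modulo all height one primes form a submonoid. -/
def regularSubmonoid [IsDomain A] [IsPrincipalIdealRing A] (hu : ∀ n : ℤ, n ≠ 0 → u ^ n ≠ 1) :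
    Submonoid R where
  carrier := heightOneRegular R
  one_mem' := (h.mem_heightOneRegular_iff hu 1).2 fun _ hf => h.one_notMem_scalarIdeal hf
  mul_mem' {r s} hr hs := by
    rw [h.mem_heightOneRegular_iff hu] at hr hs ⊢
    exact fun f hf hrs => (h.mem_or_mem_scalarIdeal hf hrs).elim (hr f hf) (hs f hf)

/-- Every nonzero element is the product of its content and a primitive element. -/
theorem exists_smul_eq [IsDomain A] [IsPrincipalIdealRing A] (hu : ∀ n : ℤ, n ≠ 0 → u ^ n ≠ 1)
    {r : R} (hr : r ≠ 0) : ∃ a : A, a ≠ 0 ∧ ∃ c ∈ heightOneRegular R, r = a • c := by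
  obtain ⟨v, hv⟩ : ∃ v, b.repr r v ≠ 0 := by
    by_contra! hcon
    exact hr (b.repr.map_eq_zero_iff.1 (Finsupp.ext hcon))
  -- Fix one nonzero coefficient. Dividing `r` by a prime scalar replaces it by a proper divisor,
  -- and proper divisibility is well founded in `A`.
  have key : ∀ α : A, ∀ r : R, b.repr r v = α → α ≠ 0 →
      ∃ a : A, a ≠ 0 ∧ ∃ c ∈ heightOneRegular R, r = a • c := by
    intro α
    induction α using (IsWellFounded.wf (α := A) (r := DvdNotUnit)).induction with
    | _ α ih =>
    intro r hr h0
    by_cases hreg : r ∈ heightOneRegular R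
    · exact ⟨1, one_ne_zero, r, hreg, (one_smul _ _).symm⟩
    · rw [h.mem_heightOneRegular_iff hu] at hreg
      push Not at hreg
      obtain ⟨f, hf, hrf⟩ := hreg
      obtain ⟨s, rfl⟩ := mem_scalarIdeal.1 hrf
      rw [map_smul, Finsupp.smul_apply, smul_eq_mul] at hr
      have h1 : b.repr s v ≠ 0 := fun h1 => h0 (by rw [← hr, h1, mul_zero])
      obtain ⟨a, ha, c, hc, rfl⟩ := ih (b.repr s v)
        ⟨h1, f, hf.not_isUnit, by rw [← hr, mul_comm]⟩ s rfl h1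
      exact ⟨f * a, mul_ne_zero hf.ne_zero ha, c, hc, smul_smul _ _ _⟩
  exact key _ r rfl hv

/-- Remove the prime factors of `a` one by one: a prime scalar that divides `cy` but not `c` divides
`y`. In the Ore condition this serves to cancel contents. -/
theorem exists_eq_smul_of_mul [IsDomain A] [IsPrincipalIdealRing A]
    (hu : ∀ n : ℤ, n ≠ 0 → u ^ n ≠ 1) {c : R} (hc : c ∈ heightOneRegular R) {a : A} (ha : a ≠ 0) :
    (∀ x y : R, a • x = c * y → ∃ y', y = a • y') ∧
      (∀ x y : R, a • x = y * c → ∃ y', y = a • y') := by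
  have : Module.IsTorsionFree A R := b.isTorsionFree
  rw [h.mem_heightOneRegular_iff hu] at hc
  induction a using UniqueFactorizationMonoid.induction_on_prime with
  | h₁ => exact absurd rfl ha
  | h₂ a hunit =>
    obtain ⟨u, rfl⟩ := hunit
    exact ⟨fun x y _ => ⟨(↑u⁻¹ : A) • y, by simp [smul_smul]⟩,
      fun x y _ => ⟨(↑u⁻¹ : A) • y, by simp [smul_smul]⟩⟩
  | h₃ a p ha0 hp ih =>
    constructor
    · intro x y hxy
      have h1 : c * y ∈ scalarIdeal A R p := mem_scalarIdeal.2 ⟨a • x, by rw [smul_smul, hxy]⟩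
      obtain ⟨y₁, rfl⟩ := mem_scalarIdeal.1 ((h.mem_or_mem_scalarIdeal hp h1).resolve_left (hc p hp))
      rw [mul_smul, mul_smul_comm] at hxy
      obtain ⟨y', rfl⟩ := (ih ha0).1 x y₁ (smul_right_injective R hp.ne_zero hxy)
      exact ⟨y', smul_smul _ _ _⟩
    · intro x y hxy
      have h1 : y * c ∈ scalarIdeal A R p := mem_scalarIdeal.2 ⟨a • x, by rw [smul_smul, hxy]⟩
      obtain ⟨y₁, rfl⟩ := mem_scalarIdeal.1
        ((h.mem_or_mem_scalarIdeal hp h1).resolve_right (hc p hp))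
      rw [mul_smul, smul_mul_assoc] at hxy
      obtain ⟨y', rfl⟩ := (ih ha0).2 x y₁ (smul_right_injective R hp.ne_zero hxy)
      exact ⟨y', smul_smul _ _ _⟩

/-- The elements that are regular modulo all height one primes form an Ore set. -/
theorem ore_heightOneRegular [IsDomain A] [IsPrincipalIdealRing A] {f₀ : A} (hf₀ : Prime f₀)
    (hu : ∀ n : ℤ, n ≠ 0 → u ^ n ≠ 1) (r : R) {c : R} (hc : c ∈ heightOneRegular R) :
    (∃ r', ∃ c' ∈ heightOneRegular R, r * c' = c * r') ∧
      (∃ r', ∃ c' ∈ heightOneRegular R, c' * r = r' * c) := by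
  have : Module.IsTorsionFree A R := b.isTorsionFree
  -- The prime `f₀` is needed here: if `A` had no primes, `0` would satisfy the condition vacuously.
  have hc0 : c ≠ 0 := by
    rintro rfl
    exact (h.mem_heightOneRegular_iff hu 0).1 hc f₀ hf₀ (TwoSidedIdeal.zero_mem _)
  obtain ⟨⟨r₁, c₁, hc₁, h₁⟩, ⟨r₂, c₂, hc₂, h₂⟩⟩ :=
    h.isMonomialBasis.ore exists_card_add_lt_int r hc0
  constructor
  -- The content `a` of the denominator divides `c * r₁`, hence `r₁`, since `c` is primitive;
  -- cancelling it leaves a primitive denominator.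
  · obtain ⟨a, ha, c', hc', rfl⟩ := h.exists_smul_eq hu hc₁
    rw [mul_smul_comm] at h₁
    obtain ⟨r', rfl⟩ := (h.exists_eq_smul_of_mul hu hc ha).1 _ _ h₁
    rw [mul_smul_comm] at h₁
    exact ⟨r', c', hc', smul_right_injective R ha h₁⟩
  · obtain ⟨a, ha, c', hc', rfl⟩ := h.exists_smul_eq hu hc₂
    rw [smul_mul_assoc] at h₂
    obtain ⟨r', rfl⟩ := (h.exists_eq_smul_of_mul hu hc ha).2 _ _ h₂
    rw [smul_mul_assoc] at h₂
    exact ⟨r', c', hc', smul_right_injective R ha h₂⟩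

/-- The localization at the elements that are regular modulo all height one primes is the ring
of fractions. -/
theorem isRingOfFractions [IsDomain A] [IsPrincipalIdealRing A] {k : Type*} [CommRing k]
    [Algebra k R] {f₀ : A} (hf₀ : Prime f₀) (hu : ∀ n : ℤ, n ≠ 0 → u ^ n ≠ 1) :
    IsRingOfFractions (heightOneRegular R) (Loc.of k (heightOneRegular R)).toRingHom := by
  have := h.isMonomialBasis.noZeroDivisors
  have : Nontrivial R := b.repr.toEquiv.nontrivial
  exact Loc.isRingOfFractions (h.regularSubmonoid hu) rfl
    (fun h0 => (h.mem_heightOneRegular_iff hu 0).1 h0 f₀ hf₀ (TwoSidedIdeal.zero_mem _))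
    (fun r _ hc => (h.ore_heightOneRegular hf₀ hu r hc).1)
    (fun r _ hc => (h.ore_heightOneRegular hf₀ hu r hc).2)

end IsTorusBasis

end QuantumTorus

/-! ### Laurent polynomials and generators of quotient algebras -/

/-- Every ideal of the localization of `k[X]` at `X` is extended from its contraction, which is
principal. -/
instance LaurentPolynomial.isPrincipalIdealRing (k : Type*) [Field k] :
    IsPrincipalIdealRing k[T;T⁻¹] where
  principal I := by
    rw [← IsLocalization.map_under (Submonoid.powers (Polynomial.X : Polynomial k)) k[T;T⁻¹] I]
    refine ⟨algebraMap _ _ (Submodule.IsPrincipal.generator (I.under (Polynomial k))), ?_⟩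
    conv_lhs => rw [← Ideal.span_singleton_generator (I.under (Polynomial k)), Ideal.map_span,
      Set.image_singleton]

theorem LaurentPolynomial.algHom_ext_T {k E : Type*} [CommSemiring k] [Semiring E] [Algebra k E]
    {f g : k[T;T⁻¹] →ₐ[k] E} (h : ∀ n, f (T n) = g (T n)) : f = g := by
  refine AlgHom.ext fun p => ?_
  induction p using LaurentPolynomial.induction_on' with
  | add p q hp hq => rw [map_add, map_add, hp, hq]
  | C_mul_T n a =>
    rw [map_mul, map_mul, h, LaurentPolynomial.C_eq_algebraMap, AlgHom.commutes, AlgHom.commutes]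

theorem RingQuot.adjoin_range_ι {k X : Type*} [CommRing k]
    (r : FreeAlgebra k X → FreeAlgebra k X → Prop) :
    Algebra.adjoin k (Set.range fun i => RingQuot.mkAlgHom k r (FreeAlgebra.ι k i)) = ⊤ := by
  have h := AlgHom.map_adjoin (RingQuot.mkAlgHom k r) (Set.range (FreeAlgebra.ι k))
  rw [FreeAlgebra.adjoin_range_ι, Algebra.map_top, ← Set.range_comp] at h
  rw [← (AlgHom.range_eq_top _).2 (RingQuot.mkAlgHom_surjective k r), h]
  rfl

theorem Submodule.eq_top_of_mul_mem {k R : Type*} [CommRing k] [Semiring R] [Algebra k R]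
    {s : Set R} (hs : Algebra.adjoin k s = ⊤) (N : Submodule k R) (h1 : 1 ∈ N)
    (hN : ∀ g ∈ s, ∀ n ∈ N, g * n ∈ N) : N = ⊤ := by
  rw [eq_top_iff]
  intro r _
  have key : ∀ r ∈ Algebra.adjoin k s, ∀ n ∈ N, r * n ∈ N := by
    intro r hr
    induction hr using Algebra.adjoin_induction with
    | mem x hx => exact hN x hx
    | algebraMap c => intro n hn; rw [← Algebra.smul_def]; exact N.smul_mem _ hn
    | add x y _ _ hx hy => intro n hn; rw [add_mul]; exact N.add_mem (hx n hn) (hy n hn)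
    | mul x y _ _ hx hy => intro n hn; rw [mul_assoc]; exact hx _ (hy n hn)
  simpa using key r (hs ▸ Algebra.mem_top) 1 h1

/-! ### The monomial basis of `𝔅` over `k[z^{±1}]` -/

namespace BB

variable {k : Type*} [Field k]

theorem qcommute : QCommute (BB.x k) (BB.y k) (BB.z k) where
  xz := Units.ext (by
    simp only [Units.val_mul, BB.x, BB.z, ← map_mul]
    exact RingQuot.mkAlgHom_rel k BRel.xz)
  yz := Units.ext (by
    simp only [Units.val_mul, BB.y, BB.z, ← map_mul]
    exact RingQuot.mkAlgHom_rel k BRel.yz)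
  xy := Units.ext (by
    simp only [Units.val_mul, Units.val_pow_eq_pow_val, BB.x, BB.y, BB.z, ← map_mul, ← map_pow]
    exact RingQuot.mkAlgHom_rel k BRel.xy)

section lift

variable {E : Type*} [Semiring E] [Algebra k E]

/-- The values on the generators of the homomorphism `BB.lift`. -/
def liftGen (X Y Z : Eˣ) : BGen → E
  | .x => X
  | .xi => (X⁻¹ : Eˣ)
  | .y => Y
  | .yi => (Y⁻¹ : Eˣ)
  | .z => Z
  | .zi => (Z⁻¹ : Eˣ)

/-- The universal property of `𝔅`. -/
noncomputable def lift {X Y Z : Eˣ} (h : QCommute X Y Z) : BB k →ₐ[k] E :=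
  RingQuot.liftAlgHom k ⟨FreeAlgebra.lift k (liftGen X Y Z), by
    have h1 := congrArg Units.val h.xz.eq
    have h2 := congrArg Units.val h.yz.eq
    have h3 := congrArg Units.val h.xy
    rintro _ _ (_ | _) <;> simp_all [liftGen]⟩

variable {X Y Z : Eˣ} (h : QCommute X Y Z)

theorem lift_mk (g : BGen) :
    lift h (RingQuot.mkAlgHom k (BRel k) (FreeAlgebra.ι k g)) = liftGen X Y Z g := by
  rw [lift, RingQuot.liftAlgHom_mkAlgHom_apply, FreeAlgebra.lift_ι_apply]

theorem lift_x : lift h (BB.x k : BB k) = X := lift_mk h .x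

theorem lift_y : lift h (BB.y k : BB k) = Y := lift_mk h .y

theorem lift_z : lift h (BB.z k : BB k) = Z := lift_mk h .z

theorem hom_ext {f g : BB k →ₐ[k] E} (hx : f (BB.x k : BB k) = g (BB.x k : BB k))
    (hy : f (BB.y k : BB k) = g (BB.y k : BB k)) (hz : f (BB.z k : BB k) = g (BB.z k : BB k)) :
    f = g := by
  have inv : ∀ u : (BB k)ˣ, f (u : BB k) = g (u : BB k) →
      f ((u⁻¹ : (BB k)ˣ) : BB k) = g ((u⁻¹ : (BB k)ˣ) : BB k) := by
    intro u hu
    have e : Units.map (f : BB k →* E) u = Units.map (g : BB k →* E) u := Units.ext hu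
    have e' := congrArg (fun t : Eˣ => ((t⁻¹ : Eˣ) : E)) e
    simp only [← map_inv] at e'
    exact e'
  refine RingQuot.ringQuot_ext' _ _ _ (FreeAlgebra.hom_ext (funext ?_))
  rintro (_ | _)
  · exact hx
  · exact inv _ hx
  · exact hy
  · exact inv _ hy
  · exact hz
  · exact inv _ hz

end lift

theorem commute_z (r : BB k) : Commute (BB.z k : BB k) r := by
  have hr : r ∈ Subalgebra.centralizer k {(BB.z k : BB k)} := by
    have h : Algebra.adjoin k _ ≤ Subalgebra.centralizer k {(BB.z k : BB k)} :=
      Algebra.adjoin_le (s := Set.range fun i => RingQuot.mkAlgHom k (BRel k) (FreeAlgebra.ι k i)) (by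
      have hx : Commute (BB.z k : BB k) (BB.x k : BB k) := congrArg Units.val qcommute.xz.symm.eq
      have hy : Commute (BB.z k : BB k) (BB.y k : BB k) := congrArg Units.val qcommute.yz.symm.eq
      have hz : Commute (BB.z k : BB k) (BB.z k : BB k) := Commute.refl _
      rintro _ ⟨i, rfl⟩
      rw [SetLike.mem_coe, Subalgebra.mem_centralizer_iff]
      rintro _ rfl
      cases i
      · exact hx.eq
      · exact hx.units_inv_right.eq
      · exact hy.eq
      · exact hy.units_inv_right.eq
      · exact hz.eq
      · exact hz.units_inv_right.eq)
    rw [RingQuot.adjoin_range_ι] at h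
    exact h Algebra.mem_top
  exact Subalgebra.mem_centralizer_iff k |>.1 hr _ rfl

/-- The embedding of `k[z^{±1}]` into `𝔅`. -/
noncomputable def zHom (k : Type*) [Field k] : k[T;T⁻¹] →ₐ[k] BB k :=
  AddMonoidAlgebra.lift k (BB k) ℤ ((Units.coeHom (BB k)).comp (zpowersHom (BB k)ˣ (BB.z k)))

theorem zHom_T (n : ℤ) : zHom k (LaurentPolynomial.T n) = ((BB.z k ^ n : (BB k)ˣ) : BB k) := by
  rw [zHom, LaurentPolynomial.T, AddMonoidAlgebra.lift_single]
  simp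

theorem commute_zHom (a : k[T;T⁻¹]) (r : BB k) : Commute (zHom k a) r := by
  induction a using LaurentPolynomial.induction_on' with
  | add p q hp hq => rw [map_add]; exact hp.add_left hq
  | C_mul_T n a =>
    rw [map_mul, LaurentPolynomial.C_eq_algebraMap, AlgHom.commutes, zHom_T]
    refine (Algebra.commute_algebraMap_left a r).mul_left ?_
    exact Commute.units_zpow_left (commute_z r) n

noncomputable instance algebraLaurent : Algebra k[T;T⁻¹] (BB k) :=
  (zHom k).toRingHom.toAlgebra' fun a r => (commute_zHom a r).eq

theorem algebraMap_eq (a : k[T;T⁻¹]) : algebraMap k[T;T⁻¹] (BB k) a = zHom k a := rfl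

instance : IsScalarTower k k[T;T⁻¹] (BB k) :=
  IsScalarTower.of_algebraMap_eq fun c => by rw [algebraMap_eq, AlgHom.commutes]

/-- The normalized monomials of `𝔅`. -/
noncomputable def mon (k : Type*) [Field k] (v : ℤ × ℤ) : (BB k)ˣ :=
  qmon (BB.x k) (BB.y k) (BB.z k) v

/-- The variable of `k[z^{±1}]` as a unit. -/
noncomputable def unitT (k : Type*) [Field k] : (k[T;T⁻¹])ˣ where
  val := LaurentPolynomial.T 1
  inv := LaurentPolynomial.T (-1)
  val_inv := by rw [← LaurentPolynomial.T_add]; rfl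
  inv_val := by rw [← LaurentPolynomial.T_add]; rfl

theorem unitT_zpow (n : ℤ) : ((unitT k ^ n : (k[T;T⁻¹])ˣ) : k[T;T⁻¹]) = LaurentPolynomial.T n := by
  induction n with
  | zero => simp
  | succ n ih => rw [zpow_add_one, Units.val_mul, ih, LaurentPolynomial.T_add]; rfl
  | pred n ih => rw [zpow_sub_one, Units.val_mul, ih, LaurentPolynomial.T_sub]; rfl

/-- The variable `z` is a generic parameter, so the quantum torus results apply to `𝔅`
unconditionally. -/
theorem unitT_zpow_ne_one (n : ℤ) (hn : n ≠ 0) : unitT k ^ n ≠ 1 := by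
  intro h
  have h1 := congrArg (fun u : (k[T;T⁻¹])ˣ => (u : k[T;T⁻¹]).coeff n) h
  simp [unitT_zpow, ← LaurentPolynomial.T_zero, hn.symm] at h1

theorem zpow_z_mul (n : ℤ) (r : BB k) :
    ((BB.z k ^ n : (BB k)ˣ) : BB k) * r = ((unitT k ^ n : (k[T;T⁻¹])ˣ) : k[T;T⁻¹]) • r := by
  rw [Algebra.smul_def, algebraMap_eq, unitT_zpow, zHom_T]

theorem mon_mul (v w : ℤ × ℤ) : (mon k v * mon k w : BB k) =
    ((unitT k ^ symp v w : (k[T;T⁻¹])ˣ) : k[T;T⁻¹]) • (mon k (v + w) : BB k) := by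
  rw [← zpow_z_mul]
  exact congrArg Units.val (qcommute.qmon_mul v w)

/-- Each generator is a monomial or a power of `z`, so the span contains `1` and is stable under
left multiplication by generators. -/
theorem span_mon : Submodule.span k[T;T⁻¹] (Set.range fun v => (mon k v : BB k)) = ⊤ := by
  set N := Submodule.span k[T;T⁻¹] (Set.range fun v => (mon k v : BB k)) with hN
  have hmul : ∀ v, ∀ n ∈ N, (mon k v : BB k) * n ∈ N := by
    intro v n hn
    induction hn using Submodule.span_induction with
    | mem x hx =>
      obtain ⟨w, rfl⟩ := hx
      simp only
      rw [mon_mul]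
      exact N.smul_mem _ (Submodule.subset_span ⟨_, rfl⟩)
    | zero => simp
    | add x y _ _ hx hy => rw [mul_add]; exact N.add_mem hx hy
    | smul a x _ hx => rw [mul_smul_comm]; exact N.smul_mem _ hx
  have hz : ∀ m : ℤ, ∀ n ∈ N, ((BB.z k ^ m : (BB k)ˣ) : BB k) * n ∈ N := fun m n hn => by
    rw [zpow_z_mul]; exact N.smul_mem _ hn
  have key := Submodule.eq_top_of_mul_mem (RingQuot.adjoin_range_ι (BRel k)) (N.restrictScalars k)
    (Submodule.subset_span ⟨0, by simp [mon, qmon]⟩) (by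
      rintro _ ⟨i, rfl⟩ n hn
      have hn' : n ∈ N := hn
      cases i
      · have := hmul (0, 1) n hn'
        simp [mon, qmon] at this
        exact this
      · have := hmul (0, -1) n hn'
        simp [mon, qmon] at this
        exact this
      · have := hmul (1, 0) n hn'
        simp [mon, qmon] at this
        exact this
      · have := hmul (-1, 0) n hn'
        simp [mon, qmon] at this
        exact this
      · have := hz 1 n hn'
        simp only [zpow_one] at this
        exact this
      · have := hz (-1) n hn'
        simp only [zpow_neg_one] at this
        exact this)
  exact (Submodule.restrictScalars_eq_top_iff k k[T;T⁻¹] (BB k)).1 key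

/-- The representation of `𝔅` by shift operators. -/
noncomputable def rep (k : Type*) [Field k] : BB k →ₐ[k] Module.End k[T;T⁻¹] (ℤ × ℤ →₀ k[T;T⁻¹]) :=
  lift (shiftUnit_spec (unitT k)).1

theorem rep_mon (v : ℤ × ℤ) : rep k (mon k v : BB k) = shiftOp (unitT k) v := by
  have h := map_qmon (Units.map (rep k : BB k →* Module.End k[T;T⁻¹] (ℤ × ℤ →₀ k[T;T⁻¹])))
    (BB.x k) (BB.y k) (BB.z k) v
  have hx : Units.map (rep k : BB k →* _) (BB.x k) = shiftUnit (unitT k) (0, 1) :=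
    Units.ext (lift_x _)
  have hy : Units.map (rep k : BB k →* _) (BB.y k) = shiftUnit (unitT k) (1, 0) :=
    Units.ext (lift_y _)
  have hz : Units.map (rep k : BB k →* _) (BB.z k) = scalarUnit (unitT k) :=
    Units.ext (lift_z _)
  rw [hx, hy, hz, (shiftUnit_spec (unitT k)).2] at h
  exact congrArg Units.val h

theorem rep_smul (a : k[T;T⁻¹]) (r : BB k) : rep k (a • r) = a • rep k r := by
  have h : (rep k).comp (zHom k) =
      IsScalarTower.toAlgHom k k[T;T⁻¹] (Module.End k[T;T⁻¹] (ℤ × ℤ →₀ k[T;T⁻¹])) := by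
    refine LaurentPolynomial.algHom_ext_T fun n => ?_
    have hz : Units.map (rep k : BB k →* _) (BB.z k) = scalarUnit (unitT k) :=
      Units.ext (lift_z _)
    have h1 : rep k ((BB.z k ^ n : (BB k)ˣ) : BB k) =
        ((scalarUnit (unitT k) ^ n : (Module.End k[T;T⁻¹] (ℤ × ℤ →₀ k[T;T⁻¹]))ˣ) :
          Module.End k[T;T⁻¹] (ℤ × ℤ →₀ k[T;T⁻¹])) := by
      rw [← hz, ← map_zpow]
      rfl
    rw [scalarUnit, ← map_zpow] at h1
    change rep k (zHom k (LaurentPolynomial.T n)) =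
      algebraMap k[T;T⁻¹] _ (LaurentPolynomial.T n)
    rw [zHom_T, h1, ← unitT_zpow]
    rfl
  rw [Algebra.smul_def, map_mul, algebraMap_eq, Algebra.smul_def]
  congr 1
  exact DFunLike.congr_fun h a

/-- Applied to the basis vector at the origin, the shift operators send the monomials to the
distinct basis vectors of a free module. -/
theorem linearIndependent_mon : LinearIndependent k[T;T⁻¹] fun v => (mon k v : BB k) := by
  let f : BB k →ₗ[k[T;T⁻¹]] (ℤ × ℤ →₀ k[T;T⁻¹]) :=
    { toFun := fun r => rep k r (Finsupp.single 0 1)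
      map_add' := fun r s => by simp
      map_smul' := fun a r => by simp [rep_smul] }
  refine LinearIndependent.of_comp f ?_
  have : f ∘ (fun v => (mon k v : BB k)) = fun v => Finsupp.single v 1 := by
    funext v
    have h0 : symp v 0 = 0 := by simp [symp]
    change rep k (mon k v : BB k) (Finsupp.single 0 1) = _
    rw [rep_mon, shiftOp_single, h0]
    simp
  rw [this]
  exact (Finsupp.basisSingleOne (R := k[T;T⁻¹]) (ι := ℤ × ℤ)).linearIndependent

/-- The basis of `𝔅` over `k[z^{±1}]` that consists of the normalized monomials. -/
noncomputable def basis (k : Type*) [Field k] : Module.Basis (ℤ × ℤ) k[T;T⁻¹] (BB k) :=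
  Module.Basis.mk linearIndependent_mon span_mon.ge

theorem basis_apply (v : ℤ × ℤ) : basis k v = mon k v := Module.Basis.mk_apply ..

theorem isTorusBasis : IsTorusBasis (basis k) (unitT k) := fun v w => by
  simp only [basis_apply, mon_mul]

end BB

/-! ### The monomial basis and the fractions of the quantum plane -/

namespace QPlane

variable {k : Type*} [Field k] (q : k)

theorem gen_mul_gen : gen q 0 * gen q 1 = q • (gen q 1 * gen q 0) := by
  have h := RingQuot.mkAlgHom_rel k (QPlaneRel.comm (q := q))
  rw [map_mul, map_smul, map_mul] at h
  exact h

section lift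

variable {q} {E : Type*} [Semiring E] [Algebra k E] {X Y : E} (h : X * Y = q • (Y * X))

/-- The universal property of the quantum plane. -/
noncomputable def lift : QPlane q →ₐ[k] E :=
  RingQuot.liftAlgHom k ⟨FreeAlgebra.lift k ![X, Y], by
    rintro _ _ ⟨⟩
    simpa using h⟩

theorem lift_gen_zero : lift h (gen q 0) = X := by
  rw [lift, gen, RingQuot.liftAlgHom_mkAlgHom_apply, FreeAlgebra.lift_ι_apply]
  rfl

theorem lift_gen_one : lift h (gen q 1) = Y := by
  rw [lift, gen, RingQuot.liftAlgHom_mkAlgHom_apply, FreeAlgebra.lift_ι_apply]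
  rfl

end lift

theorem adjoin_gen : Algebra.adjoin k (Set.range (gen q)) = ⊤ :=
  RingQuot.adjoin_range_ι (QPlaneRel q)

/-- The monomials `y^i x^j`. -/
noncomputable def mon (v : ℕ × ℕ) : QPlane q := gen q 1 ^ v.1 * gen q 0 ^ v.2

theorem gen_zero_mul_pow (n : ℕ) : gen q 0 * gen q 1 ^ n = q ^ n • (gen q 1 ^ n * gen q 0) := by
  induction n with
  | zero => simp
  | succ n ih =>
    rw [pow_succ, ← mul_assoc, ih, smul_mul_assoc, mul_assoc, gen_mul_gen, mul_smul_comm, smul_smul,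
      ← mul_assoc, ← pow_succ, ← pow_succ]

theorem pow_mul_pow (m n : ℕ) :
    gen q 0 ^ m * gen q 1 ^ n = q ^ (m * n) • (gen q 1 ^ n * gen q 0 ^ m) := by
  induction m with
  | zero => simp
  | succ m ih =>
    rw [pow_succ', mul_assoc, ih, mul_smul_comm, ← mul_assoc, gen_zero_mul_pow, smul_mul_assoc,
      smul_smul, mul_assoc, ← pow_add]
    congr 2
    ring

theorem mon_mul (v w : ℕ × ℕ) : mon q v * mon q w = q ^ (v.2 * w.1) • mon q (v + w) := by
  obtain ⟨a, c⟩ := v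
  obtain ⟨a', c'⟩ := w
  simp only [mon, Prod.mk_add_mk]
  rw [mul_assoc, ← mul_assoc (gen q 0 ^ c), pow_mul_pow, smul_mul_assoc, mul_smul_comm, pow_add,
    pow_add]
  simp only [mul_assoc]

theorem span_mon : Submodule.span k (Set.range (mon q)) = ⊤ := by
  refine Submodule.eq_top_of_mul_mem (adjoin_gen q) _ (Submodule.subset_span ⟨0, by simp [mon]⟩) ?_
  rintro _ ⟨i, rfl⟩ n hn
  obtain ⟨v, hv⟩ : ∃ v, gen q i = mon q v := by
    fin_cases i
    · exact ⟨(0, 1), by simp [mon]⟩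
    · exact ⟨(1, 0), by simp [mon]⟩
  rw [hv]
  induction hn using Submodule.span_induction with
  | mem x hx =>
    obtain ⟨w, rfl⟩ := hx
    rw [mon_mul]
    exact Submodule.smul_mem _ _ (Submodule.subset_span ⟨_, rfl⟩)
  | zero => simp
  | add x y _ _ hx hy => rw [mul_add]; exact Submodule.add_mem _ hx hy
  | smul a x _ hx => rw [mul_smul_comm]; exact Submodule.smul_mem _ _ hx

variable {q} {u : kˣ} (hu : (u : k) ^ 2 = q)

theorem shiftOp_comm (hu : (u : k) ^ 2 = q) : shiftOp u (0, 1) * shiftOp u (1, 0) =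
    q • (shiftOp u (1, 0) * shiftOp u (0, 1)) := by
  rw [shiftOp_mul, shiftOp_mul, smul_smul, ← hu, sq]
  simp [symp]

theorem lift_shiftOp_mon (v : ℕ × ℕ) :
    lift (shiftOp_comm hu) (mon q v) (Finsupp.single 0 1) =
      u ^ (-(v.1 * v.2 : ℤ)) • Finsupp.single ((v.1 : ℤ), (v.2 : ℤ)) (1 : k) := by
  have h1 : ∀ n : ℕ, (shiftOp u (0, 1) ^ n) (Finsupp.single 0 1) =
      Finsupp.single ((0 : ℤ), (n : ℤ)) (1 : k) := by
    intro n
    induction n with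
    | zero => rfl
    | succ n ih => rw [pow_succ', Module.End.mul_apply, ih, shiftOp_single]; simp [symp, add_comm]
  have h2 : ∀ n m : ℕ, (shiftOp u (1, 0) ^ n) (Finsupp.single ((0 : ℤ), (m : ℤ)) (1 : k)) =
      u ^ (-(n * m : ℤ)) • Finsupp.single ((n : ℤ), (m : ℤ)) (1 : k) := by
    intro n m
    induction n with
    | zero => simp
    | succ n ih =>
      rw [pow_succ', Module.End.mul_apply, ih, Units.smul_def, map_smul, shiftOp_single,
        Finsupp.smul_single, Units.smul_def, Finsupp.smul_single]
      simp only [symp, smul_eq_mul, mul_one, Prod.mk_add_mk]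
      rw [← Units.val_mul, ← zpow_add]
      congr 3
      · push_cast; ring
      · simp
      · push_cast; ring
  rw [mon, map_mul, map_pow, map_pow, lift_gen_zero, lift_gen_one, Module.End.mul_apply, h1, h2]

/-- With a square root `u` of `q`, the shift operators also represent the quantum plane; they move
the vector at the origin to unit multiples of distinct basis vectors. -/
theorem linearIndependent_mon (hu : (u : k) ^ 2 = q) : LinearIndependent k (mon q) := by
  let f : QPlane q →ₗ[k] (ℤ × ℤ →₀ k) :=
    (LinearMap.applyₗ (Finsupp.single 0 1)) ∘ₗ (lift (shiftOp_comm hu)).toLinearMap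
  refine LinearIndependent.of_comp f ?_
  have hinj : Function.Injective fun v : ℕ × ℕ => ((v.1 : ℤ), (v.2 : ℤ)) := by
    rintro ⟨a, c⟩ ⟨a', c'⟩ h
    simpa using h
  have h := ((Finsupp.basisSingleOne (R := k) (ι := ℤ × ℤ)).linearIndependent.comp _
    hinj).units_smul (fun v => u ^ (-(v.1 * v.2 : ℤ)))
  convert h using 1
  funext v
  exact (lift_shiftOp_mon hu v).trans (by simp)

/-- The basis of the quantum plane that consists of the monomials. -/
noncomputable def basis (hu : (u : k) ^ 2 = q) : Module.Basis (ℕ × ℕ) k (QPlane q) :=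
  Module.Basis.mk (linearIndependent_mon hu) (span_mon q).ge

theorem basis_apply (v : ℕ × ℕ) : basis hu v = mon q v := Module.Basis.mk_apply ..

theorem isMonomialBasis : IsMonomialBasis (basis hu) := fun v w =>
  ⟨(u ^ 2) ^ (v.2 * w.1), by
    simp only [basis_apply, mon_mul, Units.val_pow_eq_pow_val, hu]⟩

theorem isRingOfFractions (hu : (u : k) ^ 2 = q) :
    IsRingOfFractions {r : QPlane q | r ≠ 0} (Loc.of k {r : QPlane q | r ≠ 0}).toRingHom := by
  have := (isMonomialBasis hu).noZeroDivisors
  have : Nontrivial (QPlane q) := ⟨⟨_, _, gen_ne_zero q 0⟩⟩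
  exact Loc.isRingOfFractions
    { carrier := {r : QPlane q | r ≠ 0}
      one_mem' := one_ne_zero
      mul_mem' := fun ha hb => mul_ne_zero ha hb } rfl (fun h => h rfl)
    (fun r _ hc => let ⟨r', c', h0, h⟩ := ((isMonomialBasis hu).ore exists_card_add_lt_nat r hc).1
      ⟨r', c', h0, h⟩)
    (fun r _ hc => let ⟨r', c', h0, h⟩ := ((isMonomialBasis hu).ore exists_card_add_lt_nat r hc).2
      ⟨r', c', h0, h⟩)

end QPlane

/-! ### Evaluation of Laurent polynomials -/

section Eval

variable {k : Type*} [Field k] (a : kˣ)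

/-- Evaluation of Laurent polynomials at a unit. -/
noncomputable def evalT : k[T;T⁻¹] →ₐ[k] k :=
  AddMonoidAlgebra.lift k k ℤ ((Units.coeHom k).comp (zpowersHom kˣ a))

theorem evalT_T (n : ℤ) : evalT a (LaurentPolynomial.T n) = ((a ^ n : kˣ) : k) := by
  rw [evalT, LaurentPolynomial.T, AddMonoidAlgebra.lift_single]
  simp

/-- The Laurent polynomial `T - a`. -/
noncomputable def linT : k[T;T⁻¹] := LaurentPolynomial.T 1 - algebraMap k k[T;T⁻¹] a

/-- For the converse: modulo `T - a` every `T^n` becomes `a^n`, so the quotient map factors through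
evaluation at `a`. -/
theorem linT_dvd_iff (c : k[T;T⁻¹]) : linT a ∣ c ↔ evalT a c = 0 := by
  constructor
  · rintro ⟨d, rfl⟩
    rw [map_mul, linT, map_sub, evalT_T, AlgHom.commutes]
    simp
  · intro h
    let I := Ideal.span {linT a}
    have hT : Ideal.Quotient.mk I (LaurentPolynomial.T 1) = Ideal.Quotient.mk I (algebraMap k _ a) :=
      Ideal.Quotient.eq.2 (Ideal.mem_span_singleton_self _)
    have key : Ideal.Quotient.mkₐ k I = (Algebra.ofId k _).comp (evalT a) := by
      refine LaurentPolynomial.algHom_ext_T fun n => ?_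
      have hu : Units.map (Ideal.Quotient.mk I : k[T;T⁻¹] →* _) (BB.unitT k) =
          Units.map ((Ideal.Quotient.mk I).comp (algebraMap k k[T;T⁻¹])).toMonoidHom a := Units.ext hT
      have hn := congrArg (fun t => ((t ^ n : (k[T;T⁻¹] ⧸ I)ˣ) : k[T;T⁻¹] ⧸ I)) hu
      simp only [← map_zpow] at hn
      rw [AlgHom.comp_apply, evalT_T, ← BB.unitT_zpow]
      exact hn
    have h2 := DFunLike.congr_fun key c
    rw [AlgHom.comp_apply, h, map_zero] at h2
    exact Ideal.mem_span_singleton.1 (Ideal.Quotient.eq_zero_iff_mem.1 h2)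

theorem prime_linT : Prime (linT a) := by
  refine ⟨fun h => ?_, fun h => ?_, fun c d h => ?_⟩
  · have h1 := congrArg (fun p : k[T;T⁻¹] => p.coeff 1) h
    simp [linT, ← LaurentPolynomial.C_eq_algebraMap] at h1
  · have h1 := (linT_dvd_iff a 1).1 h.dvd
    simp at h1
  · rw [linT_dvd_iff, map_mul, mul_eq_zero] at h
    simpa only [linT_dvd_iff] using h

end Eval

/-! ### Specializing `𝔇` at `z = a` -/

/-- `E` is a division algebra generated by `X` and `Y` as such, which are independent except for
the relation `XY = a²YX`. -/
structure IsTorusField {k E : Type*} [Field k] [Ring E] [Algebra k E] (X Y : Eˣ) (a : kˣ) :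
    Prop where
  qcommute : QCommute X Y (Units.map (algebraMap k E : k →* E) a)
  isUnit : ∀ e : E, e ≠ 0 → IsUnit e
  nontrivial : Nontrivial E
  indep : LinearIndependent k fun v : ℕ × ℕ => (Y : E) ^ v.1 * (X : E) ^ v.2
  fraction : ∀ e : E, ∃ s ∈ Algebra.adjoin k {(X : E), (Y : E)},
    ∃ r ∈ Algebra.adjoin k {(X : E), (Y : E)}, s ≠ 0 ∧ s * e = r

theorem DD.isRingOfFractions (k : Type*) [Field k] :
    IsRingOfFractions (heightOneRegular (BB k)) (DD.of k).toRingHom :=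
  BB.isTorusBasis.isRingOfFractions (prime_linT (1 : kˣ)) BB.unitT_zpow_ne_one

namespace DD

variable {k : Type*} [Field k]

theorem exists_fraction (d : DD k) :
    ∃ c ∈ heightOneRegular (BB k), ∃ r, DD.of k c * d = DD.of k r := by
  obtain ⟨r, c, hc, h⟩ := (DD.isRingOfFractions k).left_fraction d
  exact ⟨c, hc, r, h⟩

theorem commute_z (d : DD k) : Commute (DD.z k : DD k) d := by
  obtain ⟨c, hc, r, h⟩ := exists_fraction d
  have hz : ∀ b, DD.of k b * (DD.z k : DD k) = (DD.z k : DD k) * DD.of k b := fun b => by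
    change DD.of k b * DD.of k (BB.z k : BB k) = DD.of k (BB.z k : BB k) * DD.of k b
    rw [← map_mul, ← map_mul, (BB.commute_z b).eq]
  apply (Loc.isUnit_of (k := k) hc).mul_left_cancel
  change DD.of k c * (DD.z k * d) = DD.of k c * (d * DD.z k)
  rw [← mul_assoc, hz, mul_assoc, h, ← mul_assoc, h, hz]

/-- The central element `z - a`. -/
noncomputable def linZ (a : kˣ) : DD k := (DD.z k : DD k) - algebraMap k (DD k) a

theorem commute_linZ (a : kˣ) (d : DD k) : Commute (linZ a) d :=
  (commute_z d).sub_left (Algebra.commute_algebraMap_left _ _)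

theorem linZ_mul_of (a : kˣ) (r : BB k) : linZ a * DD.of k r = DD.of k (linT a • r) := by
  have h : (BB.zHom k) (linT a) = (BB.z k : BB k) - algebraMap k (BB k) a := by
    rw [linT, map_sub, AlgHom.commutes, BB.zHom_T, zpow_one]
  rw [Algebra.smul_def, BB.algebraMap_eq, h, map_mul, map_sub, AlgHom.commutes]
  rfl

/-- Clear the denominator on the left; `z - a` is central and `𝔅` is torsion-free over `k[z^{±1}]`.
-/
theorem eq_zero_of_linZ_mul (a : kˣ) {d : DD k} (h : linZ a * d = 0) : d = 0 := by
  have : Module.IsTorsionFree k[T;T⁻¹] (BB k) := (BB.basis k).isTorsionFree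
  obtain ⟨c, hc, r, hr⟩ := exists_fraction d
  have h1 : DD.of k (linT a • r) = DD.of k 0 := by
    rw [← linZ_mul_of, ← hr, ← mul_assoc, (commute_linZ a _).eq, mul_assoc, h, mul_zero, map_zero]
  have h2 : linT a • r = 0 := (DD.isRingOfFractions k).injective h1
  rw [smul_eq_zero_iff_right (prime_linT a).ne_zero] at h2
  rw [h2, map_zero] at hr
  exact (Loc.isUnit_of (k := k) hc).mul_right_eq_zero.1 hr

end DD

namespace IsTorusField

variable {k E : Type*} [Field k] [Ring E] [Algebra k E] {X Y : Eˣ} {a : kˣ}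
  (H : IsTorusField X Y a)

/-- The homomorphism `𝔅 → E` that sends `x`, `y`, `z` to `X`, `Y`, `a`. -/
noncomputable def homBB : BB k →ₐ[k] E := BB.lift H.qcommute

theorem homBB_mon (v : ℤ × ℤ) : H.homBB (BB.mon k v : BB k) =
    (qmon X Y (Units.map (algebraMap k E : k →* E) a) v : Eˣ) := by
  have h := map_qmon (Units.map (H.homBB : BB k →* E)) (BB.x k) (BB.y k) (BB.z k) v
  have hx : Units.map (H.homBB : BB k →* E) (BB.x k) = X := Units.ext (BB.lift_x _)
  have hy : Units.map (H.homBB : BB k →* E) (BB.y k) = Y := Units.ext (BB.lift_y _)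
  have hz : Units.map (H.homBB : BB k →* E) (BB.z k) = Units.map (algebraMap k E : k →* E) a :=
    Units.ext (BB.lift_z _)
  rw [hx, hy, hz] at h
  exact congrArg Units.val h

theorem homBB_smul (c : k[T;T⁻¹]) (r : BB k) : H.homBB (c • r) = evalT a c • H.homBB r := by
  have h : H.homBB.comp (BB.zHom k) = (Algebra.ofId k E).comp (evalT a) := by
    refine LaurentPolynomial.algHom_ext_T fun n => ?_
    have hz : Units.map (H.homBB : BB k →* E) (BB.z k) = Units.map (algebraMap k E : k →* E) a :=
      Units.ext (BB.lift_z _)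
    have hn := congrArg (fun t => ((t ^ n : Eˣ) : E)) hz
    simp only [← map_zpow] at hn
    rw [AlgHom.comp_apply, AlgHom.comp_apply, evalT_T, BB.zHom_T]
    exact hn
  rw [Algebra.smul_def, map_mul, BB.algebraMap_eq, Algebra.smul_def]
  congr 1
  exact DFunLike.congr_fun h c

/-- Multiplying finitely many monomials by one with large exponents makes all exponents nonnegative,
where independence is assumed. -/
theorem linearIndependent_qmon (H : IsTorusField X Y a) : LinearIndependent k fun v : ℤ × ℤ =>
    ((qmon X Y (Units.map (algebraMap k E : k →* E) a) v : Eˣ) : E) := by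
  rw [linearIndependent_iff_finset_linearIndependent]
  intro s
  let N : ℕ := s.sup fun v => max v.1.natAbs v.2.natAbs
  have hN : ∀ v ∈ s, max v.1.natAbs v.2.natAbs ≤ N := fun v hv =>
    Finset.le_sup (f := fun v : ℤ × ℤ => max v.1.natAbs v.2.natAbs) hv
  let M : ℤ × ℤ := (N, N)
  let i : s → ℕ × ℕ := fun v => ((v.1.1 + N).toNat, (v.1.2 + N).toNat)
  have hi1 : ∀ v : s, (((i v).1 : ℤ), ((i v).2 : ℤ)) = M + v.1 := fun v => by
    have := hN v.1 v.2
    ext <;> simp only [i, M, Prod.fst_add, Prod.snd_add] <;> omega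
  have hi : Function.Injective i := fun v w hvw => Subtype.ext (by
    have h1 := hi1 v
    rw [hvw, hi1 w] at h1
    exact (add_left_cancel h1).symm)
  refine LinearIndependent.of_comp
    (LinearMap.mulLeft k ((qmon X Y (Units.map (algebraMap k E : k →* E) a) M : Eˣ) : E)) ?_
  convert (H.indep.comp i hi).units_smul
    -- The first factor is the twist of the product, the second the normalization of the resulting
    -- monomial.
    (fun v => a ^ symp M v.1 * a ^ (((i v).1 : ℤ) * (i v).2)) using 1
  · funext v
    have h := congrArg Units.val (H.qcommute.qmon_mul M v.1)
    simp only [Function.comp_apply, LinearMap.mulLeft_apply, Pi.smul_apply']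
    rw [Units.val_mul] at h
    rw [h, ← hi1]
    simp only [qmon, ← map_zpow, zpow_natCast, Units.smul_def, Algebra.smul_def, Units.val_mul,
      map_mul, Units.val_pow_eq_pow_val, Units.coe_map, mul_assoc]
    rfl
  · rfl

/-- Independence of the monomials in `E` forces every coefficient of `r` to vanish at `a`, hence to
be divisible by `T - a`. -/
theorem homBB_eq_zero {r : BB k} (hr : H.homBB r = 0) : ∃ s, r = linT a • s := by
  refine mem_scalarIdeal.1 ((BB.basis k).mem_scalarIdeal_iff.2 fun v => ?_)
  by_cases hv : v ∈ ((BB.basis k).repr r).support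
  · have h := hr
    rw [← (BB.basis k).linearCombination_repr r, Finsupp.linearCombination_apply, Finsupp.sum,
      map_sum] at h
    simp only [H.homBB_smul, BB.basis_apply, H.homBB_mon] at h
    exact (linT_dvd_iff a _).2 (linearIndependent_iff'.1 H.linearIndependent_qmon _ _ h v hv)
  · rw [Finsupp.notMem_support_iff.1 hv]
    exact dvd_zero _

/-- A primitive element is not divisible by the prime `T - a`, so its image in the division ring `E`
is nonzero. This is what lets the specialization extend to `𝔇`. -/
theorem isUnit_homBB (c : BB k) (hc : c ∈ heightOneRegular (BB k)) : IsUnit (H.homBB c) := by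
  refine H.isUnit _ fun h0 => ?_
  exact (BB.isTorusBasis.mem_heightOneRegular_iff BB.unitT_zpow_ne_one c).1 hc _ (prime_linT a)
    (mem_scalarIdeal.2 (H.homBB_eq_zero h0))

/-- The homomorphism `𝔇 → E` that sends `x`, `y`, `z` to `X`, `Y`, `a`. -/
noncomputable def hom : DD k →ₐ[k] E := Loc.lift H.homBB H.isUnit_homBB

theorem hom_of (r : BB k) : H.hom (DD.of k r) = H.homBB r := Loc.lift_of _ _ _

theorem hom_x : H.hom (DD.x k : DD k) = X := (H.hom_of _).trans (BB.lift_x _)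

theorem hom_y : H.hom (DD.y k : DD k) = Y := (H.hom_of _).trans (BB.lift_y _)

theorem hom_z : H.hom (DD.z k : DD k) = algebraMap k E a := (H.hom_of _).trans (BB.lift_z _)

theorem adjoin_le_range : Algebra.adjoin k {(X : E), (Y : E)} ≤ H.homBB.range := by
  refine Algebra.adjoin_le ?_
  rintro _ (rfl | rfl)
  · exact ⟨_, BB.lift_x _⟩
  · exact ⟨_, BB.lift_y _⟩

theorem hom_surjective : Function.Surjective H.hom := by
  intro e
  obtain ⟨_, hs, _, hr, hs0, he⟩ := H.fraction e
  obtain ⟨s, rfl⟩ := H.adjoin_le_range hs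
  obtain ⟨r, rfl⟩ := H.adjoin_le_range hr
  have hs0' : s ≠ 0 := by
    rintro rfl
    exact hs0 (map_zero _)
  -- The denominator `s` need not lie in `𝒞`. Its content specializes to a nonzero scalar, because
  -- `s` has nonzero image, and only the primitive part has to be inverted in `𝔇`.
  obtain ⟨α, _, c, hc, rfl⟩ := BB.isTorusBasis.exists_smul_eq BB.unitT_zpow_ne_one hs0'
  have hα : evalT a α ≠ 0 := by
    intro h0
    apply hs0
    change H.homBB (α • c) = 0
    rw [H.homBB_smul, h0, zero_smul]
  refine ⟨((Loc.unit k hc)⁻¹ : (DD k)ˣ) * DD.of k ((evalT a α)⁻¹ • r), ?_⟩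
  apply (H.isUnit_homBB c hc).mul_left_cancel
  have h1 : DD.of k c * (((Loc.unit k hc)⁻¹ : (DD k)ˣ) * DD.of k ((evalT a α)⁻¹ • r)) =
      DD.of k ((evalT a α)⁻¹ • r) := (Loc.unit k hc).mul_inv_cancel_left _
  have h2 := congrArg H.hom h1
  rw [map_mul, H.hom_of, H.hom_of, map_smul H.homBB] at h2
  rw [h2]
  change H.homBB (α • c) * e = H.homBB r at he
  rw [← he, H.homBB_smul, smul_mul_assoc, smul_smul, inv_mul_cancel₀ hα, one_smul]

theorem hom_eq_zero_iff (d : DD k) : H.hom d = 0 ↔ ∃ d', d = DD.linZ a * d' := by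
  constructor
  · intro hd
    obtain ⟨c, hc, r, hr⟩ := DD.exists_fraction d
    have h1 : H.homBB r = 0 := by rw [← H.hom_of, ← hr, map_mul, hd, mul_zero]
    obtain ⟨s, rfl⟩ := H.homBB_eq_zero h1
    refine ⟨((Loc.unit k hc)⁻¹ : (DD k)ˣ) * DD.of k s, ?_⟩
    apply (Loc.isUnit_of (k := k) hc).mul_left_cancel
    change DD.of k c * d = DD.of k c * (DD.linZ a * (((Loc.unit k hc)⁻¹ : (DD k)ˣ) * DD.of k s))
    rw [hr, ← DD.linZ_mul_of, ← mul_assoc, ← (DD.commute_linZ a _).eq, mul_assoc]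
    congr 1
    exact ((Loc.unit k hc).mul_inv_cancel_left _).symm
  · rintro ⟨d', rfl⟩
    rw [map_mul, DD.linZ, map_sub, H.hom_z, AlgHom.commutes, sub_self, zero_mul]

end IsTorusField

theorem QDiv.isTorusField {k : Type*} [Field k] {q : k} {u : kˣ} (hu : (u : k) ^ 2 = q) :
    IsTorusField (QDiv.gen q 0) (QDiv.gen q 1) u := by
  have hF := QPlane.isRingOfFractions hu
  have hadj : ∀ r : QPlane q, Loc.of k {r : QPlane q | r ≠ 0} r ∈
      Algebra.adjoin k {(QDiv.gen q 0 : QDiv q), (QDiv.gen q 1 : QDiv q)} := by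
    intro r
    have hr : r ∈ Algebra.adjoin k (Set.range (QPlane.gen q)) := by
      rw [QPlane.adjoin_gen]; exact Algebra.mem_top
    have : _ ∈ (Algebra.adjoin k (Set.range (QPlane.gen q))).map (Loc.of k {r : QPlane q | r ≠ 0}) :=
      ⟨r, hr, rfl⟩
    rw [AlgHom.map_adjoin] at this
    refine Algebra.adjoin_mono ?_ this
    rintro _ ⟨_, ⟨i, rfl⟩, rfl⟩
    fin_cases i
    · exact Or.inl rfl
    · exact Or.inr rfl
  refine ⟨⟨?_, ?_, ?_⟩, ?_, ?_, ?_, ?_⟩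
  · exact Units.ext (Algebra.commutes _ _).symm
  · exact Units.ext (Algebra.commutes _ _).symm
  · have h := congrArg (Loc.of k {r : QPlane q | r ≠ 0}) (QPlane.gen_mul_gen q)
    have hq : algebraMap k (QDiv q) q = algebraMap k (QDiv q) u ^ 2 := by rw [← map_pow, hu]
    rw [map_mul, map_smul, map_mul, Algebra.smul_def, hq, ← mul_assoc] at h
    exact Units.ext h
  · intro e he
    obtain ⟨r, s, hs, h⟩ := hF.left_fraction e
    have hr : r ≠ 0 := by
      rintro rfl
      rw [map_zero] at h
      exact he ((hF.isUnit s hs).mul_right_eq_zero.1 h)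
    have hu := hF.isUnit r hr
    rw [← h] at hu
    obtain ⟨v, hv⟩ := hF.isUnit s hs
    rw [← hv] at hu
    exact (Units.isUnit_units_mul v e).1 hu
  · exact ⟨⟨_, 0, fun h0 =>
      QPlane.gen_ne_zero q 0 (hF.injective (h0.trans (map_zero _).symm))⟩⟩
  · have h := (QPlane.linearIndependent_mon hu).map' (Loc.of k {r : QPlane q | r ≠ 0}).toLinearMap
      (LinearMap.ker_eq_bot.2 hF.injective)
    have e : (fun v : ℕ × ℕ => (QDiv.gen q 1 : QDiv q) ^ v.1 * (QDiv.gen q 0 : QDiv q) ^ v.2) =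
        (Loc.of k {r : QPlane q | r ≠ 0}).toLinearMap ∘ QPlane.mon q := funext fun v => by
      rw [Function.comp_apply, AlgHom.toLinearMap_apply, QPlane.mon, map_mul, map_pow, map_pow]
      rfl
    rw [e]
    exact h
  · intro e
    obtain ⟨r, s, hs, h⟩ := hF.left_fraction e
    exact ⟨_, hadj s, _, hadj r, fun h0 => hs (hF.injective (h0.trans (map_zero _).symm)), h⟩

theorem RatXY.isTorusField (k : Type*) [Field k] :
    IsTorusField (RatXY.gen k 0) (RatXY.gen k 1) (1 : kˣ) := by
  have hadj : ∀ p : MvPolynomial (Fin 2) k, algebraMap _ (RatXY k) p ∈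
      Algebra.adjoin k {(RatXY.gen k 0 : RatXY k), (RatXY.gen k 1 : RatXY k)} := by
    intro p
    have hp : p ∈ Algebra.adjoin k (Set.range (MvPolynomial.X (R := k) (σ := Fin 2))) := by
      rw [MvPolynomial.adjoin_range_X]; exact Algebra.mem_top
    have : _ ∈ (Algebra.adjoin k (Set.range (MvPolynomial.X (R := k) (σ := Fin 2)))).map
        (IsScalarTower.toAlgHom k (MvPolynomial (Fin 2) k) (RatXY k)) := ⟨p, hp, rfl⟩
    rw [AlgHom.map_adjoin] at this
    refine Algebra.adjoin_mono ?_ this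
    rintro _ ⟨_, ⟨i, rfl⟩, rfl⟩
    fin_cases i
    · exact Or.inl rfl
    · exact Or.inr rfl
  refine ⟨⟨Commute.all _ _, Commute.all _ _, ?_⟩, fun e he => he.isUnit, inferInstance, ?_, ?_⟩
  · rw [map_one, one_pow, one_mul, mul_comm]
  · have hinj : Function.Injective fun v : ℕ × ℕ =>
        (Finsupp.single (1 : Fin 2) v.1 + Finsupp.single (0 : Fin 2) v.2) := by
      intro v w h
      have h0 := DFunLike.congr_fun h 0
      have h1 := DFunLike.congr_fun h 1
      simp at h0 h1
      exact Prod.ext h1 h0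
    have h := (((MvPolynomial.basisMonomials (Fin 2) k).linearIndependent.comp _ hinj).map'
      (IsScalarTower.toAlgHom k (MvPolynomial (Fin 2) k) (RatXY k)).toLinearMap
      (LinearMap.ker_eq_bot.2 (IsFractionRing.injective (MvPolynomial (Fin 2) k) (RatXY k))))
    have e : (fun v : ℕ × ℕ => (RatXY.gen k 1 : RatXY k) ^ v.1 * (RatXY.gen k 0 : RatXY k) ^ v.2) =
        (IsScalarTower.toAlgHom k (MvPolynomial (Fin 2) k) (RatXY k)).toLinearMap ∘
          MvPolynomial.basisMonomials (Fin 2) k ∘ fun v : ℕ × ℕ =>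
            (Finsupp.single (1 : Fin 2) v.1 + Finsupp.single (0 : Fin 2) v.2) := by
      funext v
      simp only [RatXY.gen, Units.val_mk0, Function.comp_apply, MvPolynomial.coe_basisMonomials]
      rw [← map_pow, ← map_pow, ← map_mul, MvPolynomial.X_pow_eq_monomial,
        MvPolynomial.X_pow_eq_monomial, MvPolynomial.monomial_mul, one_mul]
      rfl
    rw [e]
    exact h
  · intro e
    obtain ⟨p, s, hs, rfl⟩ := IsFractionRing.div_surjective (A := MvPolynomial (Fin 2) k) e
    have hs0 : algebraMap _ (RatXY k) s ≠ 0 := by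
      simpa using nonZeroDivisors.ne_zero hs
    exact ⟨_, hadj s, _, hadj p, hs0, mul_div_cancel₀ _ hs0⟩

/-! ### Specializations, descent of actions and fixed rings -/

section Specialization

variable {k B E : Type*} [Field k] [Ring B] [Algebra k B] [Ring E] [Algebra k E]

/-- `Φ` is surjective and its kernel is `t B`. -/
structure IsSpecialization (Φ : B →ₐ[k] E) (t : B) : Prop where
  surjective : Function.Surjective Φ
  eq_zero_iff : ∀ d, Φ d = 0 ↔ ∃ d', d = t * d'

namespace IsSpecialization

variable {Φ : B →ₐ[k] E} {t : B}

theorem map_eq_zero (h : IsSpecialization Φ t) : Φ t = 0 := (h.eq_zero_iff t).2 ⟨1, by simp⟩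

theorem smul (h : IsSpecialization Φ t) {c : k} (hc : c ≠ 0) : IsSpecialization Φ (c • t) := by
  refine ⟨h.surjective, fun d => (h.eq_zero_iff d).trans ⟨?_, ?_⟩⟩
  · rintro ⟨d', rfl⟩
    exact ⟨c⁻¹ • d', by rw [smul_mul_smul_comm, mul_inv_cancel₀ hc, one_smul]⟩
  · rintro ⟨d', rfl⟩
    exact ⟨c • d', by rw [mul_smul_comm, smul_mul_assoc]⟩

theorem rel_iff (h : IsSpecialization Φ t) (a b : B) :
    (TwoSidedIdeal.span {t}).ringCon a b ↔ Φ a = Φ b := by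
  rw [TwoSidedIdeal.rel_iff, ← sub_eq_zero (a := Φ a), ← map_sub]
  constructor
  · intro hab
    have hle : TwoSidedIdeal.span {t} ≤ TwoSidedIdeal.ker Φ :=
      TwoSidedIdeal.span_le.2 (Set.singleton_subset_iff.2 ((TwoSidedIdeal.mem_ker Φ).2 h.map_eq_zero))
    exact (TwoSidedIdeal.mem_ker Φ).1 (hle hab)
  · intro hab
    obtain ⟨c, hc⟩ := (h.eq_zero_iff _).1 hab
    rw [hc]
    exact TwoSidedIdeal.mul_mem_right _ _ _ (TwoSidedIdeal.subset_span rfl)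

theorem exists_equiv (h : IsSpecialization Φ t) :
    ∃ e : QuotBy t ≃ₐ[k] E, ∀ b : B, e (b : QuotBy t) = Φ b := by
  let f : QuotBy t →ₐ[k] E :=
    { toFun := fun x => Quotient.liftOn' x Φ fun a b hab => (h.rel_iff a b).1 hab
      map_one' := map_one Φ
      map_zero' := map_zero Φ
      map_mul' := by rintro ⟨a⟩ ⟨b⟩; exact map_mul Φ a b
      map_add' := by rintro ⟨a⟩ ⟨b⟩; exact map_add Φ a b
      commutes' := fun r => Φ.commutes r }
  refine ⟨AlgEquiv.ofBijective f ⟨?_, fun e => ?_⟩, fun b => rfl⟩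
  · rintro ⟨a⟩ ⟨b⟩ hab
    exact Quotient.sound' ((h.rel_iff a b).2 hab)
  · obtain ⟨b, rfl⟩ := h.surjective e
    exact ⟨(b : QuotBy t), rfl⟩

end IsSpecialization

/-- Two specializations with nontrivial targets carry all ideal-theoretic conditions: `h` maps to
zero in `E₀`, so it is no unit, and `1` survives in `E`, so the second ideal is proper. -/
theorem isDeformationVia_of_isSpecialization {E₀ : Type*} [CommRing E₀] [Algebra k E₀]
    [Nontrivial E₀] [Nontrivial E] {P : PoissonBracket k E₀} {Φ₀ : B →ₐ[k] E₀} {Φ : B →ₐ[k] E}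
    {h : B} {lam : k} (central : ∀ b, h * b = b * h) (regular : ∀ b, h * b = 0 → b = 0)
    (s₀ : IsSpecialization Φ₀ h) (s : IsSpecialization Φ (h - algebraMap k B lam))
    (hlam : lam ≠ 0) (hne : h - algebraMap k B lam ≠ 0)
    (hP : ∀ a b c, a * b - b * a = h * c → P.bracket (Φ₀ a) (Φ₀ b) = Φ₀ c) :
    IsDeformationVia P E B h lam where
  central := central
  not_isUnit hu := by
    have := hu.map Φ₀
    rw [s₀.map_eq_zero] at this
    exact not_isUnit_zero this
  regular := mem_nonZeroDivisors_iff.2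
    ⟨regular, fun b hb => regular b (by rw [central, hb])⟩
  limit := by
    obtain ⟨e, he⟩ := s₀.exists_equiv
    exact ⟨e, fun a b c habc => by rw [he, he, he, hP a b c habc]⟩
  lam_ne_zero := hlam
  ideal_ne_bot h0 := hne (by
    have := TwoSidedIdeal.subset_span (s := {h - algebraMap k B lam}) rfl
    rw [h0] at this
    exact this)
  ideal_ne_top h0 := by
    have h1 : (TwoSidedIdeal.span {h - algebraMap k B lam}).ringCon 1 0 := by
      rw [TwoSidedIdeal.rel_iff, h0]
      trivial
    rw [s.rel_iff, map_one, map_zero] at h1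
    exact one_ne_zero h1
  quotient := let ⟨e, _⟩ := s.exists_equiv; ⟨e⟩

section Action

variable {Γ : Type*} [Group Γ]

/-- The endomorphism of `E` induced by an automorphism of `B` that fixes `t`. -/
noncomputable def IsSpecialization.descend {Φ : B →ₐ[k] E} {t : B} (h : IsSpecialization Φ t)
    (f : B ≃ₐ[k] B) (hf : f t = t) : E →ₐ[k] E :=
  have key : ∀ a b, Φ a = Φ b → Φ (f a) = Φ (f b) := fun a b hab => by
    rw [← sub_eq_zero, ← map_sub, h.eq_zero_iff] at hab
    obtain ⟨c, hc⟩ := hab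
    rw [← sub_eq_zero, ← map_sub, ← map_sub, hc, map_mul, hf, h.eq_zero_iff]
    exact ⟨_, rfl⟩
  have inv : ∀ e, Φ (Function.surjInv h.surjective e) = e := Function.surjInv_eq h.surjective
  { toFun := fun e => Φ (f (Function.surjInv h.surjective e))
    map_one' := (key _ 1 (by rw [inv, map_one])).trans (by simp)
    map_zero' := (key _ 0 (by rw [inv, map_zero])).trans (by simp)
    map_mul' := fun a b => (key _ (Function.surjInv h.surjective a * Function.surjInv h.surjective b)
      (by rw [map_mul, inv, inv, inv])).trans (by simp)
    map_add' := fun a b => (key _ (Function.surjInv h.surjective a + Function.surjInv h.surjective b)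
      (by rw [map_add, inv, inv, inv])).trans (by simp)
    commutes' := fun r => (key _ (algebraMap k B r) (by rw [inv, AlgHom.commutes])).trans (by simp) }

theorem IsSpecialization.descend_apply {Φ : B →ₐ[k] E} {t : B} (h : IsSpecialization Φ t)
    (f : B ≃ₐ[k] B) (hf : f t = t) (b : B) : h.descend f hf (Φ b) = Φ (f b) := by
  change Φ (f (Function.surjInv h.surjective (Φ b))) = Φ (f b)
  have hab := Function.surjInv_eq h.surjective (Φ b)
  rw [← sub_eq_zero, ← map_sub, h.eq_zero_iff] at hab
  obtain ⟨c, hc⟩ := hab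
  rw [← sub_eq_zero, ← map_sub, ← map_sub, hc, map_mul, hf, h.eq_zero_iff]
  exact ⟨_, rfl⟩

/-- The group action on `E` induced by a group action on `B` that fixes `t`. -/
noncomputable def IsSpecialization.action {Φ : B →ₐ[k] E} {t : B} (h : IsSpecialization Φ t)
    (ρ : Γ →* (B ≃ₐ[k] B)) (hρ : ∀ g, ρ g t = t) : Γ →* (E ≃ₐ[k] E) :=
  algAut
    { toFun := fun g => h.descend (ρ g) (hρ g)
      map_one' := AlgHom.ext fun e => by
        obtain ⟨b, rfl⟩ := h.surjective e
        rw [h.descend_apply]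
        simp
      map_mul' := fun g g' => AlgHom.ext fun e => by
        obtain ⟨b, rfl⟩ := h.surjective e
        rw [AlgHom.mul_apply, h.descend_apply, h.descend_apply, h.descend_apply, map_mul]
        rfl }

theorem IsSpecialization.action_apply {Φ : B →ₐ[k] E} {t : B} (h : IsSpecialization Φ t)
    (ρ : Γ →* (B ≃ₐ[k] B)) (hρ : ∀ g, ρ g t = t) (g : Γ) (b : B) :
    h.action ρ hρ g (Φ b) = Φ (ρ g b) :=
  h.descend_apply (ρ g) (hρ g) b

/-- The restriction of an equivariant homomorphism to the fixed rings. -/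
def fixedHom {ρ : Γ →* (B ≃ₐ[k] B)} {σ : Γ →* (E ≃ₐ[k] E)} {Φ : B →ₐ[k] E}
    (hΦ : ∀ g b, σ g (Φ b) = Φ (ρ g b)) (G : Subgroup Γ) : fixedRing ρ G →ₐ[k] fixedRing σ G :=
  (Φ.comp (fixedRing ρ G).val).codRestrict (fixedRing σ G) fun b g hg =>
    (hΦ g b).trans (congrArg Φ (b.2 g hg))

theorem coe_fixedHom {ρ : Γ →* (B ≃ₐ[k] B)} {σ : Γ →* (E ≃ₐ[k] E)} {Φ : B →ₐ[k] E}
    (hΦ : ∀ g b, σ g (Φ b) = Φ (ρ g b)) (G : Subgroup Γ) (b : fixedRing ρ G) :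
    (fixedHom hΦ G b : E) = Φ b := rfl

/-- Averaging over a finite group shows that specialization commutes with taking fixed rings. -/
theorem IsSpecialization.fixedHom [CharZero k] {ρ : Γ →* (B ≃ₐ[k] B)} {σ : Γ →* (E ≃ₐ[k] E)}
    {Φ : B →ₐ[k] E} (hΦ : ∀ g b, σ g (Φ b) = Φ (ρ g b)) {t : B} (h : IsSpecialization Φ t)
    (regular : ∀ b, t * b = 0 → b = 0) (G : Subgroup Γ) [Finite G] (ht : t ∈ fixedRing ρ G) :
    IsSpecialization (_root_.fixedHom hΦ G) ⟨t, ht⟩ := by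
  refine ⟨?_, fun d => ⟨fun hd => ?_, ?_⟩⟩
  · rintro ⟨e, he⟩
    have := Fintype.ofFinite G
    obtain ⟨b, rfl⟩ := h.surjective e
    have hG : (Fintype.card G : k) ≠ 0 := Nat.cast_ne_zero.2 Fintype.card_ne_zero
    -- The average over `G` of any lift is invariant and still maps to the invariant element.
    refine ⟨⟨(Fintype.card G : k)⁻¹ • ∑ g : G, ρ g b, fun g hg => ?_⟩, Subtype.ext ?_⟩
    · rw [map_smul, map_sum]
      congr 1
      refine Fintype.sum_equiv (Equiv.mulLeft (⟨g, hg⟩ : G)) _ _ fun g' => ?_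
      rw [Equiv.coe_mulLeft, Subgroup.coe_mul, map_mul]
      rfl
    · rw [coe_fixedHom, map_smul, map_sum]
      simp only [← hΦ]
      rw [Finset.sum_congr rfl fun (g : G) _ => (he g.1 g.2 : σ g.1 (Φ b) = Φ b), Finset.sum_const, Finset.card_univ,
        ← Nat.cast_smul_eq_nsmul k, smul_smul, inv_mul_cancel₀ hG, one_smul]
  · have hd' : Φ d = 0 := congrArg Subtype.val hd
    obtain ⟨d', hd'⟩ := (h.eq_zero_iff _).1 hd'
    -- The cofactor is itself invariant: `t (g d' - d') = 0` and `t` is regular.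
    refine ⟨⟨d', fun g hg => ?_⟩, Subtype.ext hd'⟩
    have h1 := d.2 g hg
    rw [hd', map_mul, ht g hg] at h1
    rw [← sub_eq_zero]
    apply regular
    rw [mul_sub, h1, sub_self]
  · rintro ⟨d', rfl⟩
    refine Subtype.ext ?_
    rw [coe_fixedHom]
    exact (h.eq_zero_iff _).2 ⟨d', rfl⟩

end Action

end Specialization

/-! ### Compatibility of commutators with a Poisson bracket -/

section Poisson

variable {k B F : Type*} [Field k] [Ring B] [Algebra k B] [CommRing F] [Algebra k F]

theorem PoissonBracket.skew (P : PoissonBracket k F) (a b : F) : P.bracket a b = -P.bracket b a := by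
  have h := P.self (a + b)
  simp only [map_add, LinearMap.add_apply, P.self, zero_add, add_zero] at h
  exact eq_neg_of_add_eq_zero_right h

theorem PoissonBracket.leibniz_left (P : PoissonBracket k F) (a b c : F) :
    P.bracket (a * b) c = a * P.bracket b c + P.bracket a c * b := by
  rw [P.skew, P.leibniz, P.skew c a, P.skew c b]
  ring

theorem PoissonBracket.algebraMap_left (P : PoissonBracket k F) (r : k) (c : F) :
    P.bracket (algebraMap k F r) c = 0 := by
  have h := P.leibniz_left 1 1 c
  rw [Algebra.algebraMap_eq_smul_one, map_smul, LinearMap.smul_apply]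
  simp only [one_mul, mul_one] at h
  rw [left_eq_add.1 h, smul_zero]

/-- The bracket `P` of the images of `a` and `b` is the image of `(ab - ba) / h`. -/
def IsCompatible (P : PoissonBracket k F) (Φ : B →ₐ[k] F) (h a b : B) : Prop :=
  ∀ c, a * b - b * a = h * c → P.bracket (Φ a) (Φ b) = Φ c

namespace IsCompatible

variable {P : PoissonBracket k F} {Φ : B →ₐ[k] F} {h : B}

theorem symm {a b : B} (hab : IsCompatible P Φ h a b) : IsCompatible P Φ h b a := fun c hc => by
  rw [P.skew, hab (-c) (by rw [mul_neg, ← hc]; abel), map_neg, neg_neg]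

theorem of_commute (regular : ∀ b, h * b = 0 → b = 0) {a b : B} (hab : Commute a b)
    (hP : P.bracket (Φ a) (Φ b) = 0) : IsCompatible P Φ h a b := fun c hc => by
  rw [hab.eq, sub_self] at hc
  rw [regular c hc.symm, hP, map_zero]

theorem algebraMap_left (regular : ∀ b, h * b = 0 → b = 0) (r : k) (b : B) :
    IsCompatible P Φ h (algebraMap k B r) b :=
  of_commute regular (Algebra.commutes r b) (by rw [AlgHom.commutes, P.algebraMap_left])

/-- The target is commutative, so commutators lie in the kernel `hB`. -/
theorem exists_commutator (s : IsSpecialization Φ h) (a b : B) : ∃ c, a * b - b * a = h * c :=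
  (s.eq_zero_iff _).1 (by rw [map_sub, map_mul, map_mul, mul_comm, sub_self])

theorem add_left (s : IsSpecialization Φ h) (regular : ∀ b, h * b = 0 → b = 0) {a a' b : B}
    (ha : IsCompatible P Φ h a b) (ha' : IsCompatible P Φ h a' b) :
    IsCompatible P Φ h (a + a') b := fun c hc => by
  obtain ⟨d, hd⟩ := exists_commutator s a b
  obtain ⟨d', hd'⟩ := exists_commutator s a' b
  have hcd : c = d + d' := sub_eq_zero.1 (regular _ (by
    rw [mul_sub, mul_add, ← hc, ← hd, ← hd']; noncomm_ring))
  rw [map_add, map_add, LinearMap.add_apply, ha d hd, ha' d' hd', hcd, map_add]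

theorem commutator_mul (central : ∀ b, h * b = b * h) (regular : ∀ b, h * b = 0 → b = 0)
    {a a' b c d d' : B} (hc : a * a' * b - b * (a * a') = h * c) (hd : a * b - b * a = h * d)
    (hd' : a' * b - b * a' = h * d') : c = a * d' + d * a' :=
  sub_eq_zero.1 (regular _ (by
    rw [mul_sub, mul_add, ← hc, ← mul_assoc h a d', central a, mul_assoc a h, ← hd', ← mul_assoc h,
      ← hd]
    noncomm_ring))

/-- For fixed `b`, both `[·, b]/h` and the bracket with the image of `b` satisfy the Leibniz rule.
-/
theorem mul_left (s : IsSpecialization Φ h) (central : ∀ b, h * b = b * h)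
    (regular : ∀ b, h * b = 0 → b = 0) {a a' b : B}
    (ha : IsCompatible P Φ h a b) (ha' : IsCompatible P Φ h a' b) :
    IsCompatible P Φ h (a * a') b := fun c hc => by
  obtain ⟨d, hd⟩ := exists_commutator s a b
  obtain ⟨d', hd'⟩ := exists_commutator s a' b
  rw [commutator_mul central regular hc hd hd', map_mul, P.leibniz_left, ha d hd, ha' d' hd']
  simp

/-- The Leibniz rule can be solved for `x` when the image of `a` is a unit; this extends
compatibility to inverses and to fractions. -/
theorem of_mul_left (s : IsSpecialization Φ h) (central : ∀ b, h * b = b * h)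
    (regular : ∀ b, h * b = 0 → b = 0) {a x b : B} (hu : IsUnit (Φ a))
    (ha : IsCompatible P Φ h a b) (hax : IsCompatible P Φ h (a * x) b) :
    IsCompatible P Φ h x b := fun c hc => by
  obtain ⟨d, hd⟩ := exists_commutator s a b
  obtain ⟨e, he⟩ := exists_commutator s (a * x) b
  have h1 := hax e he
  rw [commutator_mul central regular he hd hc, map_mul, P.leibniz_left, ha d hd, map_add, map_mul,
    map_mul] at h1
  exact hu.mul_left_cancel (add_right_cancel h1)

end IsCompatible

end Poisson

/-! ### The action of `SL₂(ℤ)` on `𝔅`, `𝔇` and the specializations -/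

namespace BB

variable {k : Type*} [Field k]

/-- The action of an element of `SL₂(ℤ)` on `𝔅`. -/
noncomputable def slHom (k : Type*) [Field k] (g : SpecialLinearGroup (Fin 2) ℤ) : BB k →ₐ[k] BB k :=
  lift (qcommute.slAct g).1

theorem map_slHom_z (g : SpecialLinearGroup (Fin 2) ℤ) :
    Units.map (slHom k g : BB k →* BB k) (BB.z k) = BB.z k := Units.ext (lift_z _)

theorem slHom_mon (g : SpecialLinearGroup (Fin 2) ℤ) (v : ℤ × ℤ) :
    Units.map (slHom k g : BB k →* BB k) (mon k v) = mon k (slAct g v) := by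
  have h := map_qmon (Units.map (slHom k g : BB k →* BB k)) (BB.x k) (BB.y k) (BB.z k) v
  have hx : Units.map (slHom k g : BB k →* BB k) (BB.x k) = mon k (slAct g (0, 1)) :=
    Units.ext (lift_x _)
  have hy : Units.map (slHom k g : BB k →* BB k) (BB.y k) = mon k (slAct g (1, 0)) :=
    Units.ext (lift_y _)
  rw [hx, hy, map_slHom_z] at h
  exact h.trans ((qcommute.slAct g).2 v)

theorem mon_zero_one : mon k (0, 1) = BB.x k := by simp [mon, qmon]

theorem mon_one_zero : mon k (1, 0) = BB.y k := by simp [mon, qmon]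

theorem hom_ext_mon {f g : BB k →ₐ[k] BB k}
    (h : ∀ v, Units.map (f : BB k →* BB k) (mon k v) = Units.map (g : BB k →* BB k) (mon k v))
    (hz : Units.map (f : BB k →* BB k) (BB.z k) = Units.map (g : BB k →* BB k) (BB.z k)) :
    f = g := by
  have hx := h (0, 1)
  have hy := h (1, 0)
  rw [mon_zero_one] at hx
  rw [mon_one_zero] at hy
  exact hom_ext (congrArg Units.val hx) (congrArg Units.val hy) (congrArg Units.val hz)

/-- The action of `SL₂(ℤ)` on `𝔅`. -/
noncomputable def slAction (k : Type*) [Field k] :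
    SpecialLinearGroup (Fin 2) ℤ →* (BB k →ₐ[k] BB k) where
  toFun := slHom k
  map_one' := hom_ext_mon (fun v => by
    rw [slHom_mon]
    have : slAct 1 v = v := by ext <;> simp [slAct]
    rw [this]
    rfl) (map_slHom_z 1)
  map_mul' g g' := hom_ext_mon (fun v => by
    rw [slHom_mon, slAct_mul, ← slHom_mon, ← slHom_mon]
    rfl) ((map_slHom_z _).trans (by
      have h := map_slHom_z (k := k) g
      conv_lhs => rw [← h, ← map_slHom_z g']
      rfl))

theorem slHom_smul (g : SpecialLinearGroup (Fin 2) ℤ) (a : k[T;T⁻¹]) (r : BB k) :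
    slHom k g (a • r) = a • slHom k g r := by
  have h : (slHom k g).comp (zHom k) = zHom k := by
    refine LaurentPolynomial.algHom_ext_T fun n => ?_
    have hn := congrArg (fun t => ((t ^ n : (BB k)ˣ) : BB k)) (map_slHom_z (k := k) g)
    simp only [← map_zpow] at hn
    rw [AlgHom.comp_apply, zHom_T]
    exact hn
  rw [Algebra.smul_def, map_mul, algebraMap_eq, Algebra.smul_def]
  congr 1
  exact DFunLike.congr_fun h a

/-- The action is linear over `k[z^{±1}]` and invertible, so it preserves divisibility by scalars,
and `𝒞` is defined by such divisibility. -/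
theorem slHom_mem (g : SpecialLinearGroup (Fin 2) ℤ) (c : BB k) (hc : c ∈ heightOneRegular (BB k)) :
    slHom k g c ∈ heightOneRegular (BB k) := by
  rw [isTorusBasis.mem_heightOneRegular_iff unitT_zpow_ne_one] at hc ⊢
  intro f hf hmem
  obtain ⟨s, hs⟩ := mem_scalarIdeal.1 hmem
  refine hc f hf (mem_scalarIdeal.2 ⟨slHom k g⁻¹ s, ?_⟩)
  rw [← slHom_smul, ← hs]
  have h : slAction k g⁻¹ * slAction k g = 1 := by rw [← map_mul, inv_mul_cancel, map_one]
  exact (DFunLike.congr_fun h c).symm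

end BB

theorem two_mul_sub_eq_neg_two_mul_sub {R : Type*} [Ring R] (a b : R) :
    2 * (a - b) = -2 * (b - a) := by
  rw [neg_mul, ← mul_neg, neg_sub]

namespace DD

variable {k : Type*} [Field k]

/-- The action of `SL₂(ℤ)` on `𝔇`. -/
noncomputable def slAction (k : Type*) [Field k] :
    SpecialLinearGroup (Fin 2) ℤ →* (DD k ≃ₐ[k] DD k) :=
  algAut (Loc.action (BB.slAction k) BB.slHom_mem)

theorem slAction_of (g : SpecialLinearGroup (Fin 2) ℤ) (r : BB k) :
    slAction k g (DD.of k r) = DD.of k (BB.slHom k g r) :=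
  Loc.action_of (BB.slAction k) BB.slHom_mem g r

theorem slAction_mon (g : SpecialLinearGroup (Fin 2) ℤ) (v : ℤ × ℤ) :
    slAction k g (DD.of k (BB.mon k v : BB k)) = DD.of k (BB.mon k (slAct g v) : BB k) :=
  (slAction_of g _).trans (congrArg (DD.of k) (congrArg Units.val (BB.slHom_mon g v)))

theorem slAction_z (g : SpecialLinearGroup (Fin 2) ℤ) : slAction k g (DD.z k : DD k) = DD.z k :=
  (slAction_of g _).trans (congrArg (DD.of k) (congrArg Units.val (BB.map_slHom_z g)))

theorem slAction_y (g : SpecialLinearGroup (Fin 2) ℤ) :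
    slAction k g (DD.y k : DD k) = DD.of k (BB.mon k (g 0 0, g 1 0) : BB k) := by
  have h := slAction_mon (k := k) g (1, 0)
  rw [BB.mon_one_zero] at h
  simp only [slAct, mul_one, mul_zero, add_zero] at h
  exact h

theorem slAction_x (g : SpecialLinearGroup (Fin 2) ℤ) :
    slAction k g (DD.x k : DD k) = DD.of k (BB.mon k (g 0 1, g 1 1) : BB k) := by
  have h := slAction_mon (k := k) g (0, 1)
  rw [BB.mon_zero_one] at h
  simp only [slAct, mul_one, mul_zero, zero_add] at h
  exact h

theorem isMonomialAction : IsMonomialAction (DD.x k) (DD.y k) (DD.z k) (slAction k) := fun g => by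
  have h : ∀ v, DD.of k (BB.mon k v : BB k) = (qmon (DD.x k) (DD.y k) (DD.z k) v : (DD k)ˣ) :=
    fun v => congrArg Units.val (map_qmon (Units.map (DD.of k : BB k →* DD k)) _ _ _ v)
  exact ⟨(slAction_y g).trans (h _), (slAction_x g).trans (h _), slAction_z g⟩

theorem slAction_linZ (a : kˣ) (g : SpecialLinearGroup (Fin 2) ℤ) :
    slAction k g (linZ a) = linZ a := by
  rw [linZ, map_sub, slAction_z, AlgEquiv.commutes]

theorem h_eq (k : Type*) [Field k] : DD.h k = (-2 : k) • linZ (1 : kˣ) := by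
  rw [DD.h, linZ, Units.val_one, map_one, Algebra.smul_def, map_neg, map_ofNat]
  exact two_mul_sub_eq_neg_two_mul_sub _ _

theorem h_sub_eq (a : kˣ) :
    DD.h k - algebraMap k (DD k) (2 * (1 - (a : k))) = (-2 : k) • linZ a := by
  rw [DD.h, linZ, Algebra.smul_def, map_mul, map_sub, map_one, map_neg, map_ofNat, ← mul_sub,
    sub_sub_sub_cancel_left]
  exact two_mul_sub_eq_neg_two_mul_sub _ _

end DD

namespace IsTorusField

variable {k E : Type*} [Field k] [Ring E] [Algebra k E] {X Y : Eˣ} {a : kˣ}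
  (H : IsTorusField X Y a)

theorem isSpecialization : IsSpecialization H.hom (DD.linZ a) :=
  ⟨H.hom_surjective, H.hom_eq_zero_iff⟩

/-- The action of `SL₂(ℤ)` on `E`. -/
noncomputable def slAction : SpecialLinearGroup (Fin 2) ℤ →* (E ≃ₐ[k] E) :=
  H.isSpecialization.action (DD.slAction k) (DD.slAction_linZ a)

theorem slAction_hom (g : SpecialLinearGroup (Fin 2) ℤ) (d : DD k) :
    H.slAction g (H.hom d) = H.hom (DD.slAction k g d) :=
  H.isSpecialization.action_apply _ _ g d

theorem isMonomialAction :
    IsMonomialAction X Y (Units.map (algebraMap k E : k →* E) a) H.slAction := fun g => by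
  refine ⟨?_, ?_, ?_⟩
  · rw [← H.hom_y, slAction_hom, DD.slAction_y, H.hom_of, H.homBB_mon]
    rfl
  · rw [← H.hom_x, slAction_hom, DD.slAction_x, H.hom_of, H.homBB_mon]
    rfl
  · exact (H.slAction g).commutes a

end IsTorusField

/-! ### Reduction of the bracket to generators -/

section Compatible

variable {k : Type*} [Field k]

/-- For fixed `b`, the compatible elements are closed under sums, products, inverses of units and
removal of denominators, hence exhaust `𝔇` once they contain `x`, `y`, `z`. -/
theorem isCompatible_of_gen {F : Type*} [CommRing F] [Algebra k F] {P : PoissonBracket k F}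
    {Φ : DD k →ₐ[k] F} {h : DD k} (s : IsSpecialization Φ h) (central : ∀ b, h * b = b * h)
    (regular : ∀ b, h * b = 0 → b = 0) {b : DD k} (hx : IsCompatible P Φ h (DD.x k : DD k) b)
    (hy : IsCompatible P Φ h (DD.y k : DD k) b) (hz : IsCompatible P Φ h (DD.z k : DD k) b)
    (a : DD k) : IsCompatible P Φ h a b := by
  have hinv : ∀ u : (DD k)ˣ, IsCompatible P Φ h (u : DD k) b →
      IsCompatible P Φ h ((u⁻¹ : (DD k)ˣ) : DD k) b := fun u hu => by
    refine IsCompatible.of_mul_left s central regular (u.isUnit.map Φ) hu ?_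
    rw [Units.mul_inv, ← map_one (algebraMap k (DD k))]
    exact IsCompatible.algebraMap_left regular 1 b
  have hB : ∀ r : BB k, IsCompatible P Φ h (DD.of k r) b := by
    intro r
    have hr : r ∈ Algebra.adjoin k
        (Set.range fun i => RingQuot.mkAlgHom k (BRel k) (FreeAlgebra.ι k i)) := by
      rw [RingQuot.adjoin_range_ι]; exact Algebra.mem_top
    induction hr using Algebra.adjoin_induction with
    | mem x hmem =>
      obtain ⟨i, rfl⟩ := hmem
      cases i
      · exact hx
      · exact hinv _ hx
      · exact hy
      · exact hinv _ hy
      · exact hz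
      · exact hinv _ hz
    | algebraMap c =>
      rw [AlgHom.commutes]
      exact IsCompatible.algebraMap_left regular c b
    | add x y _ _ hx hy => rw [map_add]; exact IsCompatible.add_left s regular hx hy
    | mul x y _ _ hx hy => rw [map_mul]; exact IsCompatible.mul_left s central regular hx hy
  obtain ⟨c, hc, r, hr⟩ := DD.exists_fraction a
  refine IsCompatible.of_mul_left s central regular ((Loc.isUnit_of (k := k) hc).map Φ) (hB c) ?_
  rw [hr]
  exact hB r

end Compatible

/-! ### The semiclassical limit and the main theorem -/

section Main

theorem two_mul_sub_sub_eq_zero {R : Type*} [Ring R] (z y x : R) :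
    2 * (y * x - z ^ 2 * y * x) - 2 * (1 - z) * ((1 + z) * y * x) = 0 := by
  noncomm_ring

theorem DD.h_central {k : Type*} [Field k] (b : DD k) : DD.h k * b = b * DD.h k := by
  rw [DD.h_eq]
  exact ((DD.commute_linZ 1 b).smul_left _).eq

variable {k : Type*} [Field k] [CharZero k]

theorem DD.eq_zero_of_h_mul (b : DD k) (hb : DD.h k * b = 0) : b = 0 := by
  rw [DD.h_eq, smul_mul_assoc] at hb
  exact DD.eq_zero_of_linZ_mul 1 ((smul_eq_zero_iff_right (by norm_num)).1 hb)

/-- The specialization `𝔇 → k(x, y)`. -/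
noncomputable def RatXY.spec (k : Type*) [Field k] : DD k →ₐ[k] RatXY k := (RatXY.isTorusField k).hom

theorem RatXY.isSpecialization : IsSpecialization (RatXY.spec k) (DD.h k) := by
  rw [DD.h_eq]
  exact (RatXY.isTorusField k).isSpecialization.smul (by norm_num)

/-- By reduction to generators in each argument, only the pair `(y, x)` carries content; all other
pairs of generators commute and have zero bracket. -/
theorem RatXY.isCompatible (a b : DD k) :
    IsCompatible (RatXY.poisson k) (RatXY.spec k) (DD.h k) a b := by
  have hx : RatXY.spec k (DD.x k : DD k) = RatXY.gen k 0 := (RatXY.isTorusField k).hom_x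
  have hy : RatXY.spec k (DD.y k : DD k) = RatXY.gen k 1 := (RatXY.isTorusField k).hom_y
  have hz : RatXY.spec k (DD.z k : DD k) = algebraMap k _ 1 := (RatXY.isTorusField k).hom_z
  have s := RatXY.isSpecialization (k := k)
  have zz : ∀ b, IsCompatible (RatXY.poisson k) (RatXY.spec k) (DD.h k) (DD.z k : DD k) b :=
    fun b => IsCompatible.of_commute DD.eq_zero_of_h_mul (DD.commute_z b) (by
      rw [hz, PoissonBracket.algebraMap_left])
  have xx : IsCompatible (RatXY.poisson k) (RatXY.spec k) (DD.h k) (DD.x k : DD k) (DD.x k : DD k) :=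
    IsCompatible.of_commute DD.eq_zero_of_h_mul (Commute.refl _) (PoissonBracket.self _ _)
  have yy : IsCompatible (RatXY.poisson k) (RatXY.spec k) (DD.h k) (DD.y k : DD k) (DD.y k : DD k) :=
    IsCompatible.of_commute DD.eq_zero_of_h_mul (Commute.refl _) (PoissonBracket.self _ _)
  have yx : IsCompatible (RatXY.poisson k) (RatXY.spec k) (DD.h k) (DD.y k : DD k)
      (DD.x k : DD k) := by
    intro c hc
    have hxy : (DD.x k * DD.y k : DD k) = (DD.z k : DD k) ^ 2 * DD.y k * DD.x k := by
      have h := congrArg (fun u : (BB k)ˣ => DD.of k (u : BB k)) (BB.qcommute (k := k)).xy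
      simp only [Units.val_mul, Units.val_pow_eq_pow_val, map_mul, map_pow] at h
      exact h
    -- The factor `h = 2(1 - z)` splits off `1 - z² = (1 - z)(1 + z)`; at `z = 1` the right side
    -- becomes `2yx`.
    have h1 : 2 * c = (1 + (DD.z k : DD k)) * DD.y k * DD.x k := by
      refine sub_eq_zero.1 (DD.eq_zero_of_h_mul _ ?_)
      have h2 : DD.h k * (2 * c) = 2 * (DD.h k * c) := by
        rw [two_mul, mul_add, two_mul]
      rw [mul_sub, h2, ← hc, hxy, DD.h]
      exact two_mul_sub_sub_eq_zero _ _ _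
    have h3 := congrArg (RatXY.spec k) h1
    simp only [map_mul, map_add, map_one, map_ofNat, hx, hy, hz] at h3
    rw [hx, hy, RatXY.poisson_gen]
    have h2 : (2 : RatXY k) ≠ 0 := by
      rw [← map_ofNat (algebraMap k (RatXY k))]
      exact (map_ne_zero _).2 two_ne_zero
    refine mul_left_cancel₀ h2 ?_
    rw [h3]
    ring
  have gx := isCompatible_of_gen s DD.h_central DD.eq_zero_of_h_mul xx yx (zz _)
  have gy := isCompatible_of_gen s DD.h_central DD.eq_zero_of_h_mul yx.symm yy (zz _)
  exact isCompatible_of_gen s DD.h_central DD.eq_zero_of_h_mul (gx b).symm (gy b).symm (zz b) a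

end Main

/-- `k` has characteristic zero, `q ∈ kˣ` is not a root of unity and `qh = q̂` is a square root
of `q`. -/
theorem theorem4p1p12 {k : Type*} [Field k] [CharZero k] (q qh : k) (hq : q ≠ 0)
    (hroot : ∀ n : ℕ, 1 ≤ n → q ^ n ≠ 1) (hqh : qh ≠ 0) (hsq : qh ^ 2 = q) :
    -- the localizations are rings of fractions: `D` of `k_q[x, y]`, and `𝔇 = 𝔅𝒞⁻¹` of `𝔅`
    IsRingOfFractions {r : QPlane q | r ≠ 0} (Loc.of k {r : QPlane q | r ≠ 0}).toRingHom ∧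
    IsRingOfFractions (heightOneRegular (BB k)) (DD.of k).toRingHom ∧
    -- `D = 𝔇 / (h - lam)𝔇` is a deformation of `k(x, y)`
    IsDeformationVia (RatXY.poisson k) (QDiv q) (DD k) (DD.h k) (2 * (1 - qh)) ∧
    -- `SL₂(ℤ)` acts on `k(x, y)`, `D` and `𝔇` by monomial automorphisms
    ∃ (ρF : Matrix.SpecialLinearGroup (Fin 2) ℤ →* (RatXY k ≃ₐ[k] RatXY k))
      (ρD : Matrix.SpecialLinearGroup (Fin 2) ℤ →* (QDiv q ≃ₐ[k] QDiv q))
      (ρDD : Matrix.SpecialLinearGroup (Fin 2) ℤ →* (DD k ≃ₐ[k] DD k)),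
      IsMonomialAction (RatXY.gen k 0) (RatXY.gen k 1) 1 ρF ∧
      IsMonomialAction (QDiv.gen q 0) (QDiv.gen q 1)
        (Units.map (algebraMap k (QDiv q)) (Units.mk0 qh hqh)) ρD ∧
      IsMonomialAction (DD.x k) (DD.y k) (DD.z k) ρDD ∧
      (∀ g a b, ρF g ((RatXY.poisson k).bracket a b) =
        (RatXY.poisson k).bracket (ρF g a) (ρF g b)) ∧
      -- `D^G` is a deformation of `k(x, y)^G`
      ∀ G : Subgroup (Matrix.SpecialLinearGroup (Fin 2) ℤ), Finite G →
        ∃ (hG : ∀ a ∈ fixedRing ρF G, ∀ b ∈ fixedRing ρF G,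
            (RatXY.poisson k).bracket a b ∈ fixedRing ρF G)
          (hh : DD.h k ∈ fixedRing ρDD G),
          IsDeformationVia ((RatXY.poisson k).restrict (fixedRing ρF G) hG) (fixedRing ρD G)
            (fixedRing ρDD G) ⟨DD.h k, hh⟩ (2 * (1 - qh)) := by
  have HD : IsTorusField (QDiv.gen q 0) (QDiv.gen q 1) (Units.mk0 qh hqh) := QDiv.isTorusField hsq
  have HF := RatXY.isTorusField k
  have hqh1 : qh ≠ 1 := by
    rintro rfl
    exact hroot 1 le_rfl (by rw [← hsq, one_pow, one_pow])
  have hlam : 2 * (1 - qh) ≠ 0 := mul_ne_zero two_ne_zero (sub_ne_zero.2 hqh1.symm)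
  have hneg : (-2 : k) ≠ 0 := neg_ne_zero.2 two_ne_zero
  have hsub : DD.h k - algebraMap k (DD k) (2 * (1 - qh)) =
      (-2 : k) • DD.linZ (Units.mk0 qh hqh) := DD.h_sub_eq (Units.mk0 qh hqh)
  have s₀ : IsSpecialization (RatXY.spec k) (DD.h k) := RatXY.isSpecialization
  have s : IsSpecialization HD.hom (DD.h k - algebraMap k (DD k) (2 * (1 - qh))) := by
    rw [hsub]
    exact HD.isSpecialization.smul hneg
  have hreg : ∀ b, (DD.h k - algebraMap k (DD k) (2 * (1 - qh))) * b = 0 → b = 0 := by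
    intro b hb
    rw [hsub, smul_mul_assoc] at hb
    exact DD.eq_zero_of_linZ_mul _ ((smul_eq_zero_iff_right hneg).1 hb)
  have hne : DD.h k - algebraMap k (DD k) (2 * (1 - qh)) ≠ 0 := by
    have := HD.nontrivial
    intro h0
    have h1 := hreg 1 (by rw [h0, zero_mul])
    exact one_ne_zero ((map_one HD.hom).symm.trans ((congrArg HD.hom h1).trans (map_zero _)))
  have := HD.nontrivial
  have hF : ∀ g d, HF.slAction g (RatXY.spec k d) = RatXY.spec k (DD.slAction k g d) :=
    HF.slAction_hom
  have hP : ∀ g a b, HF.slAction g ((RatXY.poisson k).bracket a b) =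
      (RatXY.poisson k).bracket (HF.slAction g a) (HF.slAction g b) := by
    intro g a b
    obtain ⟨a, rfl⟩ := s₀.surjective a
    obtain ⟨b, rfl⟩ := s₀.surjective b
    -- Lift to `𝔇`, where the bracket is `(ab - ba)/h`; the action preserves commutators and fixes
    -- `h`.
    obtain ⟨c, hc⟩ := IsCompatible.exists_commutator s₀ a b
    have hh : DD.slAction k g (DD.h k) = DD.h k := by
      rw [DD.h_eq, map_smul, DD.slAction_linZ]
    have hc' := congrArg (DD.slAction k g) hc
    rw [map_sub, map_mul, map_mul, map_mul, hh] at hc'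
    rw [RatXY.isCompatible a b c hc, hF, hF, hF, RatXY.isCompatible _ _ _ hc']
  refine ⟨QPlane.isRingOfFractions (u := Units.mk0 qh hqh) hsq, DD.isRingOfFractions k,
    isDeformationVia_of_isSpecialization DD.h_central DD.eq_zero_of_h_mul s₀ s hlam hne
      (fun a b => RatXY.isCompatible a b), HF.slAction, HD.slAction, DD.slAction k, ?_,
    HD.isMonomialAction, DD.isMonomialAction, hP, fun G _ => ?_⟩
  · have h := HF.isMonomialAction
    rw [map_one] at h
    exact h
  · have hh : DD.h k ∈ fixedRing (DD.slAction k) G := fun g _ => by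
      rw [DD.h_eq, map_smul, DD.slAction_linZ]
    have hh' : DD.h k - algebraMap k (DD k) (2 * (1 - qh)) ∈ fixedRing (DD.slAction k) G :=
      sub_mem hh (Subalgebra.algebraMap_mem _ _)
    have hG : ∀ a ∈ fixedRing HF.slAction G, ∀ b ∈ fixedRing HF.slAction G,
        (RatXY.poisson k).bracket a b ∈ fixedRing HF.slAction G := fun a ha b hb g hg => by
      rw [hP, ha g hg, hb g hg]
    refine ⟨hG, hh, isDeformationVia_of_isSpecialization
      (fun b => Subtype.ext (DD.h_central _))
      (fun b hb => Subtype.ext (DD.eq_zero_of_h_mul _ (congrArg Subtype.val hb)))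
      (s₀.fixedHom hF DD.eq_zero_of_h_mul G hh) (s.fixedHom HD.slAction_hom hreg G hh') hlam
      (fun h0 => hne (congrArg Subtype.val h0)) ?_⟩
    intro a b c hc
    exact Subtype.ext (RatXY.isCompatible (a : DD k) b c (congrArg Subtype.val hc))
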